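/- Let $(A,[\,,],\rho)$ be a (real, smooth, finite rank) Lie algebroid over a smooth manifold $M$ without boundary, and write $d_Af=\rho^*df$ for $f\in C^\infty(M)$. A bivector field $\pi\in\Gamma(\wedge^2A)$ has the sharp map $\pi^\sharp:A^*\to A$, $\langle\beta,\pi^\sharp\alpha\rangle=\pi(\alpha,\beta)$; it is Poisson if $[\pi,\pi]_A=0$, and then $[\alpha,\beta]_\pi=\mathcal L_{\pi^\sharp\alpha}\beta-\mathcal L_{\pi^\sharp\beta}\alpha-d_A(\pi(\alpha,\beta))$ is the associated bracket on $\Gamma(A^*)$. For functions $f$ put $d_\pi f=[\pi,f]_A=-\pi^\sharp d_Af\in\Gamma(A)$. Let $(A,\pi,N)$ be a Poisson--Nijenhuis Lie algebroid, that is: $\pi$ is a Poisson structure on $A$; $N:A\to A$ is a smooth bundle map over the identity which is a Nijenhuis operator, $N([NX,Y]+[X,NY]-N[X,Y])=[NX,NY]$ for $X,Y\in\Gamma(A)$; and $\pi$ and $N$ are compatible, i.e. $N\pi$ (with sharp map $N\circ\pi^\sharp$) is a bivector field and $$[\alpha,\beta]_{N\pi}=[N^*\alpha,\beta]_\pi+[\alpha,N^*\beta]_\pi-N^*[\alpha,\beta]_\pi\qquad(\alpha,\beta\in\Gamma(A^*)).$$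 Suppose that $N$ is non-degenerate (invertible on every fibre). Let $X_{(N,\pi)}=d_\pi(\mathrm{Tr}\,N)\in\Gamma(A)$ be the modular vector field, let $X^k=N^{k-1}X_{(N,\pi)}$ for $k\in\mathbb Z$, and let $$h_0=\ln|\det N|,\qquad h_i=\tfrac1i\mathrm{Tr}\,N^i\quad(i\in\mathbb Z,\ i\ne0).$$ For $j\in\mathbb Z$ let $N^j\pi$ have sharp map $N^j\circ\pi^\sharp$, and let $\pi_j$ be the tensor on $M$ with $\pi_j^\sharp=\rho\circ N^j\pi^\sharp\circ\rho^*:T^*M\to TM$. Then: 1. The $h_i$ are smooth functions on $M$, and the $\pi_j$ $(j\in\mathbb Z)$ are (classical) Poisson structures on $M$, any two of which are compatible (their sum is again Poisson). 2. $X_{(N,\pi)}$ covers the vector field $\rho(X_{(N,\pi)})$ on $M$, which is bi-Hamiltonian for the compatible pair $(\pi_0,\pi_1)$: it is a Hamiltonian vector field both for $\pi_0$ and for $\pi_1$. 3. The $X^k$ $(k\in\mathbb Z)$ are smooth sections of $A$ and satisfy, for all $i,j\in\mathbb Z$, $$X^{i+j}=d_{N^i\pi}h_j=d_{N^j\pi}h_i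 .$$ 4. This hierarchy covers the hierarchy $X_k=\rho(X^k)$ of vector fields on $M$, which is given for all $i,j\in\mathbb Z$ by $$X_{i+j}=-\pi_i^\sharp dh_j=-\pi_j^\sharp dh_i .$$ -/

import Mathlib

open Bundle Manifold
open scoped ContDiff

noncomputable section

namespace PNAlgebroid

/-!
Conventions: `M` is a smooth manifold without boundary modelled on `E`, and `A` is a smooth real
vector bundle over `M` with typical fibre `F`.  All bundle maps cover the identity of `M`.
-/

section Bundles

variable (E : Type*) [NormedAddCommGroup E] [NormedSpace ℝ E]
  {M : Type*} [TopologicalSpace M] [ChartedSpace E M]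
  (F : Type*) [NormedAddCommGroup F] [NormedSpace ℝ F]
  (A : M → Type*) [TopologicalSpace (TotalSpace F A)]
  [∀ x, AddCommGroup (A x)] [∀ x, Module ℝ (A x)] [∀ x, TopologicalSpace (A x)]
  [∀ x, IsTopologicalAddGroup (A x)] [∀ x, ContinuousSMul ℝ (A x)]
  [FiberBundle F A] [VectorBundle ℝ F A]

/-- `Γ(A)`: smooth sections of `A`. -/
abbrev Sec := ContMDiffSection 𝓘(ℝ, E) F ∞ A

/-- `Γ(A^*)`: smooth sections of the dual bundle. -/
abbrev Form := ContMDiffSection 𝓘(ℝ, E) (F →L[ℝ] ℝ) ∞ (fun x : M => A x →L[ℝ] ℝ)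

/-- Smooth bundle maps `A → A`. -/
abbrev EndField := ContMDiffSection 𝓘(ℝ, E) (F →L[ℝ] F) ∞ (fun x : M => A x →L[ℝ] A x)

/-- Smooth contravariant 2-tensors on `A`, given by their sharp maps `P^♯ : A^* → A`; the tensor is
`P(α, β) = ⟨β, P^♯ α⟩`.  Bivector fields `P ∈ Γ(∧² A)` are the skew-symmetric ones. -/
abbrev TwoTensor :=
  ContMDiffSection 𝓘(ℝ, E) ((F →L[ℝ] ℝ) →L[ℝ] F) ∞ (fun x : M => (A x →L[ℝ] ℝ) →L[ℝ] A x)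

variable {E F A}

/-- The sharp map `P^♯` is skew: `⟨β, P^♯ α⟩ = - ⟨α, P^♯ β⟩`. -/
def IsSkew (P : Π x : M, (A x →L[ℝ] ℝ) →L[ℝ] A x) : Prop :=
  ∀ (x : M) (α β : A x →L[ℝ] ℝ), β (P x α) = - α (P x β)

/-- The section `f X`, for `f ∈ C^∞(M)`. -/
def fsmul (f : M → ℝ) (hf : ContMDiff 𝓘(ℝ, E) 𝓘(ℝ, ℝ) ∞ f) (X : Sec E F A) : Sec E F A :=
  ⟨fun x => f x • X x, hf.smul_section X.contMDiff⟩

/-- The action of a bundle map `N : A → A` on sections. -/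
def EndField.onSec (N : EndField E F A) (X : Sec E F A) : Sec E F A :=
  ⟨fun x => N x (X x), N.contMDiff.clm_bundle_apply X.contMDiff⟩

/-- The sharp map on sections, `P^♯ : Γ(A^*) → Γ(A)`. -/
def TwoTensor.sharp (P : TwoTensor E F A) (α : Form E F A) : Sec E F A :=
  ⟨fun x => P x (α x), P.contMDiff.clm_bundle_apply α.contMDiff⟩

/-- The transpose of a bundle map on sections, `N^* : Γ(A^*) → Γ(A^*)`, `N^* α = α ∘ N`. -/
def EndField.transpose (N : EndField E F A) (α : Form E F A) : Form E F A :=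
  ⟨fun x => (α x).comp (N x), by
    intro x₀
    have hN := (contMDiffAt_hom_bundle _).1 (N.contMDiff x₀)
    have hα := (contMDiffAt_hom_bundle _).1 (α.contMDiff x₀)
    refine (contMDiffAt_hom_bundle _).2 ⟨contMDiffAt_id, ?_⟩
    refine (hα.2.clm_comp hN.2).congr_of_eventuallyEq ?_
    filter_upwards [(trivializationAt F A x₀).open_baseSet.mem_nhds
      (FiberBundle.mem_baseSet_trivializationAt' x₀)] with x hx
    ext v
    simp [ContinuousLinearMap.inCoordinates, hx]⟩

variable (E F A)

/-- A Lie algebroid structure on `A → M`: a Lie bracket on `Γ(A)` and a smooth bundle map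
`ρ : A → TM`, the anchor, with `[X, f Y] = f [X, Y] + (ρ(X) f) Y`. -/
structure LieAlgebroid [IsManifold 𝓘(ℝ, E) ∞ M] where
  bracket : Sec E F A → Sec E F A → Sec E F A
  anchor : ContMDiffSection 𝓘(ℝ, E) (F →L[ℝ] E) ∞
    (fun x : M => A x →L[ℝ] TangentSpace 𝓘(ℝ, E) x)
  bracket_add_right : ∀ X Y Z, bracket X (Y + Z) = bracket X Y + bracket X Z
  bracket_smul_right : ∀ (c : ℝ) (X Y), bracket X (c • Y) = c • bracket X Y
  bracket_skew : ∀ X Y, bracket X Y = - bracket Y X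
  jacobi : ∀ X Y Z,
    bracket X (bracket Y Z) + bracket Y (bracket Z X) + bracket Z (bracket X Y) = 0
  leibniz : ∀ (X Y : Sec E F A) (f : M → ℝ) (hf : ContMDiff 𝓘(ℝ, E) 𝓘(ℝ, ℝ) ∞ f) (x : M),
    bracket X (fsmul f hf Y) x =
      f x • bracket X Y x + mvfderiv 𝓘(ℝ, E) f x (anchor x (X x)) • Y x

end Bundles

section Base

variable {E : Type*} [NormedAddCommGroup E] [NormedSpace ℝ E]
  {M : Type*} [TopologicalSpace M] [ChartedSpace E M]

/-- The vector field `P^♯ df` of a contravariant 2-tensor `P` on `M` given by its sharp map. -/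
def hamVF (P : Π x : M, (TangentSpace 𝓘(ℝ, E) x →L[ℝ] ℝ) →L[ℝ] TangentSpace 𝓘(ℝ, E) x)
    (f : M → ℝ) (x : M) : TangentSpace 𝓘(ℝ, E) x :=
  P x (mvfderiv 𝓘(ℝ, E) f x)

/-- `{f, g}_P = P(df, dg) = ⟨dg, P^♯ df⟩`. -/
def pbracket (P : Π x : M, (TangentSpace 𝓘(ℝ, E) x →L[ℝ] ℝ) →L[ℝ] TangentSpace 𝓘(ℝ, E) x)
    (f g : M → ℝ) (x : M) : ℝ :=
  mvfderiv 𝓘(ℝ, E) g x (hamVF P f x)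

/-- A (classical) Poisson structure on `M`: a smooth bivector field, given by its sharp map, whose
bracket on `C^∞(M)` satisfies the Jacobi identity. -/
structure IsPoissonStructure [IsManifold 𝓘(ℝ, E) ∞ M]
    (P : Π x : M, (TangentSpace 𝓘(ℝ, E) x →L[ℝ] ℝ) →L[ℝ] TangentSpace 𝓘(ℝ, E) x) : Prop where
  smooth : ContMDiff 𝓘(ℝ, E) (𝓘(ℝ, E).prod 𝓘(ℝ, (E →L[ℝ] ℝ) →L[ℝ] E)) ∞
    (fun x => TotalSpace.mk' ((E →L[ℝ] ℝ) →L[ℝ] E)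
      (E := fun x : M => (TangentSpace 𝓘(ℝ, E) x →L[ℝ] ℝ) →L[ℝ] TangentSpace 𝓘(ℝ, E) x) x (P x))
  skew : IsSkew P
  jacobi : ∀ f g h : M → ℝ, ContMDiff 𝓘(ℝ, E) 𝓘(ℝ, ℝ) ∞ f → ContMDiff 𝓘(ℝ, E) 𝓘(ℝ, ℝ) ∞ g →
    ContMDiff 𝓘(ℝ, E) 𝓘(ℝ, ℝ) ∞ h → ∀ x,
    pbracket P f (pbracket P g h) x + pbracket P g (pbracket P h f) x
      + pbracket P h (pbracket P f g) x = 0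

/-- Compatible Poisson structures: the sum is again a Poisson structure. -/
structure IsCompatible [IsManifold 𝓘(ℝ, E) ∞ M]
    (P Q : Π x : M, (TangentSpace 𝓘(ℝ, E) x →L[ℝ] ℝ) →L[ℝ] TangentSpace 𝓘(ℝ, E) x) : Prop where
  left : IsPoissonStructure P
  right : IsPoissonStructure Q
  sum : IsPoissonStructure (fun x => P x + Q x)

/-- `X = P^♯ df` for some `f ∈ C^∞(M)`. -/
def IsHamiltonian
    (P : Π x : M, (TangentSpace 𝓘(ℝ, E) x →L[ℝ] ℝ) →L[ℝ] TangentSpace 𝓘(ℝ, E) x)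
    (X : Π x : M, TangentSpace 𝓘(ℝ, E) x) : Prop :=
  ∃ f : M → ℝ, ContMDiff 𝓘(ℝ, E) 𝓘(ℝ, ℝ) ∞ f ∧ ∀ x, X x = hamVF P f x

/-- `X` is bi-Hamiltonian for the pair `(P, Q)`: `P` and `Q` are compatible Poisson structures and
`X` is Hamiltonian with respect to both. -/
structure IsBiHamiltonian [IsManifold 𝓘(ℝ, E) ∞ M]
    (P Q : Π x : M, (TangentSpace 𝓘(ℝ, E) x →L[ℝ] ℝ) →L[ℝ] TangentSpace 𝓘(ℝ, E) x)
    (X : Π x : M, TangentSpace 𝓘(ℝ, E) x) : Prop where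
  compatible : IsCompatible P Q
  left : IsHamiltonian P X
  right : IsHamiltonian Q X

end Base

section Calculus

variable {E : Type*} [NormedAddCommGroup E] [NormedSpace ℝ E]
  {M : Type*} [TopologicalSpace M] [ChartedSpace E M] [IsManifold 𝓘(ℝ, E) ∞ M]
  {F : Type*} [NormedAddCommGroup F] [NormedSpace ℝ F]
  {A : M → Type*} [TopologicalSpace (TotalSpace F A)]
  [∀ x, AddCommGroup (A x)] [∀ x, Module ℝ (A x)] [∀ x, TopologicalSpace (A x)]
  [∀ x, IsTopologicalAddGroup (A x)] [∀ x, ContinuousSMul ℝ (A x)]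
  [FiberBundle F A] [VectorBundle ℝ F A]

/-- The differential `d_A f = ρ^* df`, i.e. `(d_A f)(v) = ρ(v) f`. -/
def LieAlgebroid.dA (L : LieAlgebroid E F A) (f : M → ℝ) (x : M) : A x →L[ℝ] ℝ :=
  (mvfderiv 𝓘(ℝ, E) f x).comp (L.anchor x)

/-- The Lie derivative of an `A`-1-form, evaluated on a section:
`(ℒ_X α)(Z) = ρ(X)(α(Z)) - α([X, Z])`. -/
def LieAlgebroid.lieDeriv (L : LieAlgebroid E F A) (X : Sec E F A) (α : Form E F A)
    (Z : Sec E F A) (x : M) : ℝ :=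
  L.dA (fun y => α y (Z y)) x (X x) - α x (L.bracket X Z x)

/-- The bracket `[α, β]_P = ℒ_{P^♯ α} β - ℒ_{P^♯ β} α - d_A (P(α, β))` of two `A`-1-forms,
evaluated on a section `Z`.  The bivector `P` enters through its sharp map on sections. -/
def LieAlgebroid.formBracket (L : LieAlgebroid E F A) (S : Form E F A → Sec E F A)
    (α β : Form E F A) (Z : Sec E F A) (x : M) : ℝ :=
  L.lieDeriv (S α) β Z x - L.lieDeriv (S β) α Z x - L.dA (fun y => β y (S α y)) x (Z x)

/-- The Schouten bracket `[P, P]_A` of a bivector field, evaluated on three `A`-1-forms: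
`[P, P](α, β, γ) = ∑_cyc (ρ(P^♯ α)(P(β, γ)) - P([α, β]_P, γ))`.
Since `P` is skew, `- P(θ, γ) = θ(P^♯ γ)` for every 1-form `θ`. -/
def LieAlgebroid.schoutenSelf (L : LieAlgebroid E F A) (P : TwoTensor E F A)
    (α β γ : Form E F A) (x : M) : ℝ :=
  (L.dA (fun y => γ y (P y (β y))) x (P x (α x))
      + L.formBracket P.sharp α β (P.sharp γ) x)
    + (L.dA (fun y => α y (P y (γ y))) x (P x (β x))
      + L.formBracket P.sharp β γ (P.sharp α) x)
    + (L.dA (fun y => β y (P y (α y))) x (P x (γ x))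
      + L.formBracket P.sharp γ α (P.sharp β) x)

/-- A Poisson structure on the Lie algebroid `A`: a bivector field `P` with `[P, P]_A = 0`. -/
structure LieAlgebroid.IsPoisson (L : LieAlgebroid E F A) (P : TwoTensor E F A) : Prop where
  skew : IsSkew P
  schouten_eq_zero : ∀ α β γ x, L.schoutenSelf P α β γ x = 0

/-- The deformed bracket `[X, Y]_N = [NX, Y] + [X, NY] - N[X, Y]`. -/
def LieAlgebroid.deformed (L : LieAlgebroid E F A) (N : EndField E F A) (X Y : Sec E F A) :
    Sec E F A :=
  L.bracket (N.onSec X) Y + L.bracket X (N.onSec Y) - N.onSec (L.bracket X Y)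

/-- `N` is a Nijenhuis operator: `N[X, Y]_N = [NX, NY]`. -/
def LieAlgebroid.IsNijenhuis (L : LieAlgebroid E F A) (N : EndField E F A) : Prop :=
  ∀ X Y : Sec E F A, N.onSec (L.deformed N X Y) = L.bracket (N.onSec X) (N.onSec Y)

/-- The bracket `[α, β]_{N^*} = [N^*α, β]_π + [α, N^*β]_π - N^*[α, β]_π`, the deformation of
`[ , ]_π` along `N^*`, evaluated on a section `Z`. -/
def LieAlgebroid.deformedFormBracket (L : LieAlgebroid E F A) (P : TwoTensor E F A)
    (N : EndField E F A) (α β : Form E F A) (Z : Sec E F A) (x : M) : ℝ :=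
  L.formBracket P.sharp (N.transpose α) β Z x + L.formBracket P.sharp α (N.transpose β) Z x
    - L.formBracket P.sharp α β (N.onSec Z) x

/-- `(A, π, N)` is a Poisson-Nijenhuis Lie algebroid: `π` is Poisson, `N` is Nijenhuis, and they are
compatible, i.e. `Nπ` (with sharp map `N ∘ π^♯`) is a bivector field and
`[ , ]_{Nπ} = [ , ]_{N^*}`. -/
structure LieAlgebroid.IsPN (L : LieAlgebroid E F A) (P : TwoTensor E F A) (N : EndField E F A) :
    Prop where
  poisson : L.IsPoisson P
  nijenhuis : L.IsNijenhuis N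
  skew : IsSkew (fun x => (N x).comp (P x))
  bracket_eq : ∀ α β Z x,
    L.formBracket (fun θ => N.onSec (P.sharp θ)) α β Z x = L.deformedFormBracket P N α β Z x

/-- The differential `d_P f = [P, f]_A = - P^♯ (d_A f)` of a function, a section of `A`; see
`apply_dP` for its description as a Lie algebroid differential. -/
def LieAlgebroid.dP (L : LieAlgebroid E F A) (P : Π x : M, (A x →L[ℝ] ℝ) →L[ℝ] A x)
    (f : M → ℝ) (x : M) : A x :=
  - P x (L.dA f x)

/-- `d_P f` is the differential of `f` for the Lie algebroid `A^*` with anchor `ρ ∘ P^♯`. -/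
theorem LieAlgebroid.apply_dP (L : LieAlgebroid E F A)
    (P : Π x : M, (A x →L[ℝ] ℝ) →L[ℝ] A x) (hP : IsSkew P) (f : M → ℝ) (x : M)
    (α : A x →L[ℝ] ℝ) :
    α (L.dP P f x) = mvfderiv 𝓘(ℝ, E) f x (L.anchor x (P x α)) := by
  have h := hP x α (L.dA f x)
  simp only [LieAlgebroid.dP, map_neg, ← h]
  rfl

/-- The modular vector field `X_{(N, π)} = d_π (Tr N)`. -/
def LieAlgebroid.modularVF (L : LieAlgebroid E F A) (P : TwoTensor E F A) (N : EndField E F A)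
    (x : M) : A x :=
  L.dP P (fun y => LinearMap.trace ℝ (A y) (N y : A y →ₗ[ℝ] A y)) x

/-- `N` is non-degenerate: it is invertible on each fibre. -/
def Nondeg (N : EndField E F A) : Prop := ∀ x : M, IsUnit (N x)

/-- The integer powers `N^k` of a non-degenerate `N`. -/
def power (N : EndField E F A) (hN : Nondeg N) (k : ℤ) (x : M) : A x →L[ℝ] A x :=
  (((hN x).unit ^ k : (A x →L[ℝ] A x)ˣ) : A x →L[ℝ] A x)

/-- The sharp map `N^k ∘ π^♯` of `N^k π`. -/
def powerTensor (P : TwoTensor E F A) (N : EndField E F A) (hN : Nondeg N) (k : ℤ) (x : M) :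
    (A x →L[ℝ] ℝ) →L[ℝ] A x :=
  (power N hN k x).comp (P x)

/-- `h_0 = ln |det N|` (`Real.log` is the logarithm of the absolute value) and
`h_i = (1 / i) Tr N^i` for `i ≠ 0`. -/
def hamFun (N : EndField E F A) (hN : Nondeg N) (i : ℤ) (x : M) : ℝ :=
  if i = 0 then Real.log (LinearMap.det (N x : A x →ₗ[ℝ] A x))
  else (1 / (i : ℝ)) * LinearMap.trace ℝ (A x) (power N hN i x : A x →ₗ[ℝ] A x)

/-- The hierarchy `X^k = N^{k-1} X_{(N, π)}` of `A`-vector fields. -/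
def LieAlgebroid.hierarchy (L : LieAlgebroid E F A) (P : TwoTensor E F A) (N : EndField E F A)
    (hN : Nondeg N) (k : ℤ) (x : M) : A x :=
  power N hN (k - 1) x (L.modularVF P N x)

/-- The vector field on `M` covered by an `A`-vector field. -/
def LieAlgebroid.covered (L : LieAlgebroid E F A) (X : Π x : M, A x) (x : M) :
    TangentSpace 𝓘(ℝ, E) x :=
  L.anchor x (X x)

/-- The 2-tensor `π_j` on `M` covered by `N^j π`, with sharp map `ρ ∘ N^j π^♯ ∘ ρ^*`. -/
def LieAlgebroid.basePoisson (L : LieAlgebroid E F A) (P : TwoTensor E F A) (N : EndField E F A)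
    (hN : Nondeg N) (j : ℤ) (x : M) :
    (TangentSpace 𝓘(ℝ, E) x →L[ℝ] ℝ) →L[ℝ] TangentSpace 𝓘(ℝ, E) x :=
  ((L.anchor x).comp (powerTensor P N hN j x)).comp
    (ContinuousLinearMap.precomp ℝ (L.anchor x))

end Calculus

end PNAlgebroid

end

set_option linter.unusedSectionVars false
set_option synthInstance.maxHeartbeats 200000

/-! Everything rests on reading the Nijenhuis condition as `ℒ_{NX} N = N ℒ_X N`. The relation
`ℒ_{KX} K' = K ℒ_X K'` (`Hereditary`) between commuting bundle maps is symmetric and survives sums,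
composites and inverses, so it holds between any two integer powers of `N`. Hence `N^i` and `N^i +
N^j` are again Nijenhuis.

For the Poisson structures, the failure of `[ , ]_{KP}` to be the deformation of `[ , ]_P` along
`K^*` is measured by `concomitant`. It is additive in `K` and, on hereditary pairs, a cocycle for
composition, so it vanishes on all `N^k` and their sums once it vanishes on `N`. A Nijenhuis `K`
with vanishing concomitant makes `K π^♯` a morphism of brackets, because `π^♯` is one
(`IsPoisson.formBracket_comp_sharp`). On exact forms, and because the anchor is a Lie algebra
morphism (`dA_bracket`), this is the Jacobi identity on `M`.

The hierarchy comes from the recursion `N^* d_A h_i = d_A h_{i+1}` (`IsNijenhuis.dA_hamFun_apply`).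
In a trivialization `N` is a matrix function `n`, `ℒ_X N` is the derivative of `n` along `ρ(X)` plus
a commutator with `n`, and `dh_i = tr(n^{i-1} dn)`, also for `i = 0`. Multiplying the hereditary
identity by `n^{i-1}` and taking traces removes the commutators. Since `π^♯ N^* = N π^♯`, powers of
`N` can then be moved between the tensor and the Hamiltonian. -/

namespace PNAlgebroid

/-! ### Smoothness of composites, transposes, inverses and powers of bundle maps -/

section Smoothness

variable {E : Type*} [NormedAddCommGroup E] [NormedSpace ℝ E]
  {M : Type*} [TopologicalSpace M] [ChartedSpace E M]
  {F₁ : Type*} [NormedAddCommGroup F₁] [NormedSpace ℝ F₁]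
  {E₁ : M → Type*} [TopologicalSpace (TotalSpace F₁ E₁)]
  [∀ x, AddCommGroup (E₁ x)] [∀ x, Module ℝ (E₁ x)] [∀ x, TopologicalSpace (E₁ x)]
  [∀ x, IsTopologicalAddGroup (E₁ x)] [∀ x, ContinuousSMul ℝ (E₁ x)]
  [FiberBundle F₁ E₁] [VectorBundle ℝ F₁ E₁]
  {F₂ : Type*} [NormedAddCommGroup F₂] [NormedSpace ℝ F₂]
  {E₂ : M → Type*} [TopologicalSpace (TotalSpace F₂ E₂)]
  [∀ x, AddCommGroup (E₂ x)] [∀ x, Module ℝ (E₂ x)] [∀ x, TopologicalSpace (E₂ x)]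
  [∀ x, IsTopologicalAddGroup (E₂ x)] [∀ x, ContinuousSMul ℝ (E₂ x)]
  [FiberBundle F₂ E₂] [VectorBundle ℝ F₂ E₂]
  {F₃ : Type*} [NormedAddCommGroup F₃] [NormedSpace ℝ F₃]
  {E₃ : M → Type*} [TopologicalSpace (TotalSpace F₃ E₃)]
  [∀ x, AddCommGroup (E₃ x)] [∀ x, Module ℝ (E₃ x)] [∀ x, TopologicalSpace (E₃ x)]
  [∀ x, IsTopologicalAddGroup (E₃ x)] [∀ x, ContinuousSMul ℝ (E₃ x)]
  [FiberBundle F₃ E₃] [VectorBundle ℝ F₃ E₃]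

open ContinuousLinearMap in
theorem inCoordinates_comp {x₀ x : M} (hx : x ∈ (trivializationAt F₂ E₂ x₀).baseSet)
    (ψ : E₂ x →L[ℝ] E₃ x) (φ : E₁ x →L[ℝ] E₂ x) :
    inCoordinates F₁ E₁ F₃ E₃ x₀ x x₀ x (ψ.comp φ) =
      (inCoordinates F₂ E₂ F₃ E₃ x₀ x x₀ x ψ).comp
        (inCoordinates F₁ E₁ F₂ E₂ x₀ x x₀ x φ) := by
  ext v
  simp [inCoordinates, hx]

theorem contMDiff_clm_bundle_comp {ψ : Π x, E₂ x →L[ℝ] E₃ x} {φ : Π x, E₁ x →L[ℝ] E₂ x}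
    (hψ : ContMDiff 𝓘(ℝ, E) (𝓘(ℝ, E).prod 𝓘(ℝ, F₂ →L[ℝ] F₃)) ∞
      (fun x => TotalSpace.mk' (F₂ →L[ℝ] F₃) (E := fun x : M => E₂ x →L[ℝ] E₃ x) x (ψ x)))
    (hφ : ContMDiff 𝓘(ℝ, E) (𝓘(ℝ, E).prod 𝓘(ℝ, F₁ →L[ℝ] F₂)) ∞
      (fun x => TotalSpace.mk' (F₁ →L[ℝ] F₂) (E := fun x : M => E₁ x →L[ℝ] E₂ x) x (φ x))) :
    ContMDiff 𝓘(ℝ, E) (𝓘(ℝ, E).prod 𝓘(ℝ, F₁ →L[ℝ] F₃)) ∞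
      (fun x => TotalSpace.mk' (F₁ →L[ℝ] F₃) (E := fun x : M => E₁ x →L[ℝ] E₃ x) x
        ((ψ x).comp (φ x))) := by
  intro x₀
  have h₁ := (contMDiffAt_hom_bundle _).1 (hψ x₀)
  have h₂ := (contMDiffAt_hom_bundle _).1 (hφ x₀)
  refine (contMDiffAt_hom_bundle _).2 ⟨contMDiffAt_id, ?_⟩
  refine (h₁.2.clm_comp h₂.2).congr_of_eventuallyEq ?_
  filter_upwards [(trivializationAt F₂ E₂ x₀).open_baseSet.mem_nhds
    (FiberBundle.mem_baseSet_trivializationAt' x₀)] with x hx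
  exact inCoordinates_comp hx _ _

/-- Supplies the factor `ρ^*` of the tensors on the base. In coordinates it is a fixed continuous
linear map, `compL.flip`, applied to the coordinate expression of `φ`. -/
theorem contMDiff_precomp {φ : Π x, E₁ x →L[ℝ] E₂ x}
    (hφ : ContMDiff 𝓘(ℝ, E) (𝓘(ℝ, E).prod 𝓘(ℝ, F₁ →L[ℝ] F₂)) ∞
      (fun x => TotalSpace.mk' (F₁ →L[ℝ] F₂) (E := fun x : M => E₁ x →L[ℝ] E₂ x) x (φ x))) :
    ContMDiff 𝓘(ℝ, E) (𝓘(ℝ, E).prod 𝓘(ℝ, (F₂ →L[ℝ] ℝ) →L[ℝ] (F₁ →L[ℝ] ℝ))) ∞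
      (fun x => TotalSpace.mk' ((F₂ →L[ℝ] ℝ) →L[ℝ] (F₁ →L[ℝ] ℝ))
        (E := fun x : M => (E₂ x →L[ℝ] ℝ) →L[ℝ] (E₁ x →L[ℝ] ℝ)) x
        (ContinuousLinearMap.precomp ℝ (φ x))) := by
  intro x₀
  have h := (contMDiffAt_hom_bundle _).1 (hφ x₀)
  refine (contMDiffAt_hom_bundle _).2 ⟨contMDiffAt_id, ?_⟩
  have hc : ContMDiffAt 𝓘(ℝ, E) 𝓘(ℝ, (F₂ →L[ℝ] ℝ) →L[ℝ] (F₁ →L[ℝ] ℝ)) ∞ (fun x =>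
      (ContinuousLinearMap.compL ℝ F₁ F₂ ℝ).flip
        (ContinuousLinearMap.inCoordinates F₁ E₁ F₂ E₂ x₀ x x₀ x (φ x))) x₀ := by
    have hL : ContDiff ℝ ∞ (fun ψ => (ContinuousLinearMap.compL ℝ F₁ F₂ ℝ).flip ψ) :=
      ContinuousLinearMap.contDiff _
    exact ContMDiffAt.comp x₀ hL.contMDiff.contMDiffAt h.2
  refine hc.congr_of_eventuallyEq ?_
  filter_upwards [(trivializationAt F₂ E₂ x₀).open_baseSet.mem_nhds
    (FiberBundle.mem_baseSet_trivializationAt' x₀), (trivializationAt F₁ E₁ x₀).open_baseSet.mem_nhds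
    (FiberBundle.mem_baseSet_trivializationAt' x₀)] with x hx hx'
  ext α v
  -- The dual trivialization composes with the inverse of the trivialization of `E₂`, so its inverse
  -- composes with that trivialization itself.
  have hα : (trivializationAt (F₂ →L[ℝ] ℝ) (fun b : M => E₂ b →L[ℝ] ℝ) x₀).symm x α =
      α.comp ((trivializationAt F₂ E₂ x₀).continuousLinearMapAt ℝ x) := by
    have hmem : x ∈ (trivializationAt (F₂ →L[ℝ] ℝ) (fun b : M => E₂ b →L[ℝ] ℝ) x₀).baseSet := by
      simpa using hx
    have h' := (trivializationAt (F₂ →L[ℝ] ℝ) (fun b : M => E₂ b →L[ℝ] ℝ) x₀).symm_apply_apply_mk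
      hmem (α.comp ((trivializationAt F₂ E₂ x₀).continuousLinearMapAt ℝ x))
    rw [← h', hom_trivializationAt_apply]
    congr 1
    ext w
    simp [ContinuousLinearMap.inCoordinates, hx]
  simp [ContinuousLinearMap.inCoordinates, hx, hx', hα, hom_trivializationAt_apply]

theorem contMDiff_mvfderiv [IsManifold 𝓘(ℝ, E) ∞ M] {f : M → ℝ} (hf : ContMDiff 𝓘(ℝ, E) 𝓘(ℝ, ℝ) ∞ f) :
    ContMDiff 𝓘(ℝ, E) (𝓘(ℝ, E).prod 𝓘(ℝ, E →L[ℝ] ℝ)) ∞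
      (fun x => TotalSpace.mk' (E →L[ℝ] ℝ)
        (E := fun x : M => TangentSpace 𝓘(ℝ, E) x →L[ℝ] ℝ) x (mvfderiv 𝓘(ℝ, E) f x)) := by
  intro x₀
  refine (contMDiffAt_hom_bundle _).2 ⟨contMDiffAt_id, ?_⟩
  have := (hf x₀).mfderiv_const (m := ∞) (by simp)
  refine this.congr_of_eventuallyEq (Filter.Eventually.of_forall fun x => ?_)
  ext v
  simp [inTangentCoordinates, ContinuousLinearMap.inCoordinates, mvfderiv]
  rfl

open ContinuousLinearMap in
theorem inCoordinates_one {x₀ x : M} (hx : x ∈ (trivializationAt F₁ E₁ x₀).baseSet) :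
    inCoordinates F₁ E₁ F₁ E₁ x₀ x x₀ x (1 : E₁ x →L[ℝ] E₁ x) = 1 := by
  ext v
  simp [inCoordinates, hx]

theorem contMDiff_clm_bundle_one :
    ContMDiff 𝓘(ℝ, E) (𝓘(ℝ, E).prod 𝓘(ℝ, F₁ →L[ℝ] F₁)) ∞
      (fun x => TotalSpace.mk' (F₁ →L[ℝ] F₁) (E := fun x : M => E₁ x →L[ℝ] E₁ x) x 1) := by
  intro x₀
  refine (contMDiffAt_hom_bundle _).2 ⟨contMDiffAt_id, ?_⟩
  refine (contMDiffAt_const (c := (1 : F₁ →L[ℝ] F₁))).congr_of_eventuallyEq ?_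
  filter_upwards [(trivializationAt F₁ E₁ x₀).open_baseSet.mem_nhds
    (FiberBundle.mem_baseSet_trivializationAt' x₀)] with x hx
  exact inCoordinates_one hx

/-- The representation of the endomorphisms of a fibre by those of the typical fibre. -/
noncomputable def inCoordinatesHom {x₀ x : M} (hx : x ∈ (trivializationAt F₁ E₁ x₀).baseSet) :
    (E₁ x →L[ℝ] E₁ x) →* (F₁ →L[ℝ] F₁) where
  toFun := ContinuousLinearMap.inCoordinates F₁ E₁ F₁ E₁ x₀ x x₀ x
  map_one' := inCoordinates_one hx
  map_mul' := inCoordinates_comp hx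

/-- In a trivialization the fibrewise inverse is `Ring.inverse` of the coordinate expression, which
is smooth at units. -/
theorem contMDiff_clm_bundle_inv [CompleteSpace F₁] {u : Π x, (E₁ x →L[ℝ] E₁ x)ˣ}
    (hu : ContMDiff 𝓘(ℝ, E) (𝓘(ℝ, E).prod 𝓘(ℝ, F₁ →L[ℝ] F₁)) ∞
      (fun x => TotalSpace.mk' (F₁ →L[ℝ] F₁) (E := fun x : M => E₁ x →L[ℝ] E₁ x) x (u x))) :
    ContMDiff 𝓘(ℝ, E) (𝓘(ℝ, E).prod 𝓘(ℝ, F₁ →L[ℝ] F₁)) ∞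
      (fun x => TotalSpace.mk' (F₁ →L[ℝ] F₁) (E := fun x : M => E₁ x →L[ℝ] E₁ x) x
        (↑(u x)⁻¹ : E₁ x →L[ℝ] E₁ x)) := by
  intro x₀
  have h := (contMDiffAt_hom_bundle _).1 (hu x₀)
  have hx₀ := FiberBundle.mem_baseSet_trivializationAt' (F := F₁) (E := E₁) x₀
  refine (contMDiffAt_hom_bundle _).2 ⟨contMDiffAt_id, ?_⟩
  have hc := ContMDiffAt.comp x₀ (contDiffAt_ringInverse ℝ
    (Units.map (inCoordinatesHom hx₀) (u x₀)) (n := ∞)).contMDiffAt h.2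
  refine hc.congr_of_eventuallyEq ?_
  filter_upwards [(trivializationAt F₁ E₁ x₀).open_baseSet.mem_nhds hx₀] with x hx
  exact (Ring.inverse_unit (Units.map (inCoordinatesHom hx) (u x))).symm

theorem contMDiff_clm_bundle_zpow [CompleteSpace F₁] {u : Π x, (E₁ x →L[ℝ] E₁ x)ˣ}
    (hu : ContMDiff 𝓘(ℝ, E) (𝓘(ℝ, E).prod 𝓘(ℝ, F₁ →L[ℝ] F₁)) ∞
      (fun x => TotalSpace.mk' (F₁ →L[ℝ] F₁) (E := fun x : M => E₁ x →L[ℝ] E₁ x) x (u x)))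
    (k : ℤ) :
    ContMDiff 𝓘(ℝ, E) (𝓘(ℝ, E).prod 𝓘(ℝ, F₁ →L[ℝ] F₁)) ∞
      (fun x => TotalSpace.mk' (F₁ →L[ℝ] F₁) (E := fun x : M => E₁ x →L[ℝ] E₁ x) x
        (↑(u x ^ k) : E₁ x →L[ℝ] E₁ x)) := by
  induction k with
  | zero => simpa using contMDiff_clm_bundle_one
  | succ k ih =>
    simp only [zpow_add_one, Units.val_mul]
    exact contMDiff_clm_bundle_comp ih hu
  | pred k ih =>
    simp only [zpow_sub_one, Units.val_mul]
    exact contMDiff_clm_bundle_comp ih (contMDiff_clm_bundle_inv hu)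

end Smoothness

/-! ### Powers of a Nijenhuis operator and the hereditary relation -/

section Operators

variable {E : Type*} [NormedAddCommGroup E] [NormedSpace ℝ E]
  {M : Type*} [TopologicalSpace M] [ChartedSpace E M]
  {F : Type*} [NormedAddCommGroup F] [NormedSpace ℝ F]
  {A : M → Type*} [TopologicalSpace (TotalSpace F A)]
  [∀ x, AddCommGroup (A x)] [∀ x, Module ℝ (A x)] [∀ x, TopologicalSpace (A x)]
  [∀ x, IsTopologicalAddGroup (A x)] [∀ x, ContinuousSMul ℝ (A x)]
  [FiberBundle F A] [VectorBundle ℝ F A]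

/-- The composition of two bundle maps. -/
noncomputable def EndField.comp (K K' : EndField E F A) : EndField E F A :=
  ⟨fun x => (K x).comp (K' x), contMDiff_clm_bundle_comp K.contMDiff K'.contMDiff⟩

variable (E F A) in
/-- The identity bundle map. -/
noncomputable def EndField.one : EndField E F A :=
  ⟨fun _ => 1, contMDiff_clm_bundle_one⟩

/-- The bundle map `N^k`. -/
noncomputable def powerField [CompleteSpace F] (N : EndField E F A) (hN : Nondeg N) (k : ℤ) : EndField E F A :=
  ⟨power N hN k, contMDiff_clm_bundle_zpow (u := fun x => (hN x).unit) N.contMDiff k⟩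

theorem powerField_apply [CompleteSpace F] (N : EndField E F A) (hN : Nondeg N) (k : ℤ) (x : M) :
    powerField N hN k x = power N hN k x := rfl

theorem power_zero (N : EndField E F A) (hN : Nondeg N) (x : M) : power N hN 0 x = 1 := by
  simp [power]

theorem power_one (N : EndField E F A) (hN : Nondeg N) (x : M) : power N hN 1 x = N x := by
  simp [power]

theorem power_add (N : EndField E F A) (hN : Nondeg N) (i j : ℤ) (x : M) :
    power N hN (i + j) x = (power N hN i x).comp (power N hN j x) := by
  simp only [power, zpow_add, Units.val_mul, ContinuousLinearMap.mul_def]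

theorem powerField_zero [CompleteSpace F] (N : EndField E F A) (hN : Nondeg N) :
    powerField N hN 0 = EndField.one E F A :=
  ContMDiffSection.ext fun x => power_zero N hN x

theorem powerField_one [CompleteSpace F] (N : EndField E F A) (hN : Nondeg N) :
    powerField N hN 1 = N :=
  ContMDiffSection.ext fun x => power_one N hN x

theorem powerField_add [CompleteSpace F] (N : EndField E F A) (hN : Nondeg N) (i j : ℤ) :
    powerField N hN (i + j) = (powerField N hN i).comp (powerField N hN j) :=
  ContMDiffSection.ext fun x => power_add N hN i j x

theorem powerField_comp_comm [CompleteSpace F] (N : EndField E F A) (hN : Nondeg N) (i j : ℤ) :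
    (powerField N hN i).comp (powerField N hN j) = (powerField N hN j).comp (powerField N hN i) := by
  rw [← powerField_add, ← powerField_add, add_comm]

namespace EndField

theorem onSec_add (K : EndField E F A) (X Y : Sec E F A) :
    K.onSec (X + Y) = K.onSec X + K.onSec Y :=
  ContMDiffSection.ext fun x => map_add (K x) (X x) (Y x)

theorem onSec_sub (K : EndField E F A) (X Y : Sec E F A) :
    K.onSec (X - Y) = K.onSec X - K.onSec Y :=
  ContMDiffSection.ext fun x => map_sub (K x) (X x) (Y x)

theorem onSec_neg (K : EndField E F A) (X : Sec E F A) : K.onSec (-X) = -K.onSec X :=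
  ContMDiffSection.ext fun x => map_neg (K x) (X x)

theorem add_onSec (K K' : EndField E F A) (X : Sec E F A) :
    (K + K').onSec X = K.onSec X + K'.onSec X := rfl

theorem comp_onSec (K K' : EndField E F A) (X : Sec E F A) :
    (K.comp K').onSec X = K.onSec (K'.onSec X) := rfl

theorem one_onSec (X : Sec E F A) : (one E F A).onSec X = X := rfl

theorem onSec_comm {K K' : EndField E F A} (h : K.comp K' = K'.comp K) (X : Sec E F A) :
    K.onSec (K'.onSec X) = K'.onSec (K.onSec X) := by
  rw [← comp_onSec, h, comp_onSec]

end EndField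

variable [IsManifold 𝓘(ℝ, E) ∞ M]

namespace LieAlgebroid

variable (L : LieAlgebroid E F A)

theorem bracket_add_left (X Y Z : Sec E F A) :
    L.bracket (X + Y) Z = L.bracket X Z + L.bracket Y Z := by
  rw [L.bracket_skew, L.bracket_add_right, L.bracket_skew X, L.bracket_skew Y]
  abel

theorem bracket_neg_right (X Y : Sec E F A) : L.bracket X (-Y) = -L.bracket X Y := by
  simpa using L.bracket_smul_right (-1) X Y

/-- The Lie derivative `ℒ_X K` of a bundle map, evaluated on a section. -/
noncomputable def lieEnd (X : Sec E F A) (K : EndField E F A) (Z : Sec E F A) : Sec E F A :=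
  L.bracket X (K.onSec Z) - K.onSec (L.bracket X Z)

theorem lieEnd_add_left (X Y : Sec E F A) (K : EndField E F A) (Z : Sec E F A) :
    L.lieEnd (X + Y) K Z = L.lieEnd X K Z + L.lieEnd Y K Z := by
  simp only [lieEnd, bracket_add_left, EndField.onSec_add]
  abel

theorem lieEnd_add (X : Sec E F A) (K K' : EndField E F A) (Z : Sec E F A) :
    L.lieEnd X (K + K') Z = L.lieEnd X K Z + L.lieEnd X K' Z := by
  simp only [lieEnd, EndField.add_onSec, bracket_add_right]
  abel

theorem lieEnd_one (X Z : Sec E F A) : L.lieEnd X (EndField.one E F A) Z = 0 := by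
  simp [lieEnd, EndField.one_onSec]

theorem lieEnd_comp (X : Sec E F A) (K K' : EndField E F A) (Z : Sec E F A) :
    L.lieEnd X (K.comp K') Z = L.lieEnd X K (K'.onSec Z) + K.onSec (L.lieEnd X K' Z) := by
  simp only [lieEnd, EndField.comp_onSec, EndField.onSec_sub]
  abel

/-- `ℒ_{KX} K' = K ℒ_X K'` for all sections `X`. -/
def Hereditary (K K' : EndField E F A) : Prop :=
  ∀ X Z : Sec E F A, L.lieEnd (K.onSec X) K' Z = K.onSec (L.lieEnd X K' Z)

variable {L}

/-- Both conditions are the same four brackets, grouped differently. Separating the two roles of `N`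
is what permits an induction on each exponent. -/
theorem IsNijenhuis.hereditary {N : EndField E F A} (h : L.IsNijenhuis N) : L.Hereditary N N := by
  intro X Z
  have := h X Z
  simp only [lieEnd, ← this, deformed, EndField.onSec_sub, EndField.onSec_add]
  abel

theorem Hereditary.isNijenhuis {N : EndField E F A} (h : L.Hereditary N N) : L.IsNijenhuis N := by
  intro X Z
  have := h X Z
  simp only [lieEnd, EndField.onSec_sub, sub_eq_iff_eq_add] at this
  simp only [this, deformed, EndField.onSec_sub, EndField.onSec_add]
  abel

namespace Hereditary

variable {K K' K'' : EndField E F A}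

/-- After antisymmetry, the four brackets for `(K, K')` at `(Z, X)` are those for `(K', K)` at `(X,
Z)`. -/
theorem symm (h : L.Hereditary K K') (hc : K.comp K' = K'.comp K) : L.Hereditary K' K := by
  intro X Z
  have := h Z X
  simp only [lieEnd, EndField.onSec_sub, sub_eq_iff_eq_add] at this ⊢
  rw [L.bracket_skew, this, L.bracket_skew Z (K'.onSec X), L.bracket_skew Z X,
    L.bracket_skew (K.onSec Z) X]
  simp only [EndField.onSec_neg, EndField.onSec_comm hc]
  abel

theorem add_right (h : L.Hereditary K K') (h' : L.Hereditary K K'') :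
    L.Hereditary K (K' + K'') := by
  intro X Z
  rw [lieEnd_add, lieEnd_add, h, h', EndField.onSec_add]

theorem add_left (h : L.Hereditary K K'') (h' : L.Hereditary K' K'') :
    L.Hereditary (K + K') K'' := by
  intro X Z
  rw [EndField.add_onSec, lieEnd_add_left, h, h', EndField.add_onSec]

theorem one_right : L.Hereditary K (EndField.one E F A) := by
  intro X Z
  rw [lieEnd_one, lieEnd_one]
  exact ContMDiffSection.ext fun x => (map_zero (K x)).symm

/-- `ℒ_Y` is a derivation of composition; commutativity lets `K` pass through `K'`. -/
theorem comp_right (h : L.Hereditary K K') (h' : L.Hereditary K K'')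
    (hc : K.comp K' = K'.comp K) : L.Hereditary K (K'.comp K'') := by
  intro X Z
  rw [lieEnd_comp, lieEnd_comp, h, h', EndField.onSec_add, EndField.onSec_comm hc]

theorem inverse_right (h : L.Hereditary K K') (h₁ : K''.comp K' = EndField.one E F A)
    (h₂ : K'.comp K'' = EndField.one E F A) (hc : K.comp K'' = K''.comp K) :
    L.Hereditary K K'' := by
  intro X Z
  have hZ : Z = K'.onSec (K''.onSec Z) := by
    rw [← EndField.comp_onSec, h₂, EndField.one_onSec]
  -- This is the derivative of `K'' K' = 1` along `Y`.
  have key : ∀ Y W, L.lieEnd Y K'' (K'.onSec W) = - K''.onSec (L.lieEnd Y K' W) := by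
    intro Y W
    have := L.lieEnd_comp Y K'' K' W
    rw [h₁, lieEnd_one] at this
    exact eq_neg_of_add_eq_zero_left this.symm
  rw [hZ, key, key, h, EndField.onSec_neg, EndField.onSec_comm hc]

theorem powerField_right [CompleteSpace F] {N : EndField E F A} (hN : Nondeg N)
    (h : L.Hereditary K N) (hc : ∀ k, K.comp (powerField N hN k) = (powerField N hN k).comp K)
    (k : ℤ) : L.Hereditary K (powerField N hN k) := by
  have h1 : L.Hereditary K (powerField N hN 1) := by rwa [powerField_one]
  have h2 : L.Hereditary K (powerField N hN (-1)) := by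
    refine h1.inverse_right ?_ ?_ (hc _)
    · rw [← powerField_add, ← powerField_zero N hN]; rfl
    · rw [← powerField_add, ← powerField_zero N hN]; rfl
  induction k with
  | zero => rw [powerField_zero]; exact one_right
  | succ k ih => rw [powerField_add]; exact ih.comp_right h1 (hc _)
  | pred k ih => rw [sub_eq_add_neg, powerField_add]; exact ih.comp_right h2 (hc _)

end Hereditary

/-- Only the second slot admits a direct induction: pass from `(N, N)` to `(N, N^i)`, swap, and
induct again. -/
theorem IsNijenhuis.hereditary_powerField [CompleteSpace F] {N : EndField E F A}
    (h : L.IsNijenhuis N) (hN : Nondeg N) (i j : ℤ) :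
    L.Hereditary (powerField N hN i) (powerField N hN j) := by
  refine Hereditary.powerField_right hN (Hereditary.symm ?_ ?_)
    (fun k => powerField_comp_comm N hN i k) j
  · refine h.hereditary.powerField_right hN (fun k => ?_) i
    simpa only [powerField_one] using powerField_comp_comm N hN 1 k
  · simpa only [powerField_one] using powerField_comp_comm N hN 1 i

end LieAlgebroid

end Operators

/-! ### Compatibility of a bivector with the powers of a bundle map -/

section Compatibility

variable {E : Type*} [NormedAddCommGroup E] [NormedSpace ℝ E]
  {M : Type*} [TopologicalSpace M] [ChartedSpace E M] [IsManifold 𝓘(ℝ, E) ∞ M]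
  {F : Type*} [NormedAddCommGroup F] [NormedSpace ℝ F]
  {A : M → Type*} [TopologicalSpace (TotalSpace F A)]
  [∀ x, AddCommGroup (A x)] [∀ x, Module ℝ (A x)] [∀ x, TopologicalSpace (A x)]
  [∀ x, IsTopologicalAddGroup (A x)] [∀ x, ContinuousSMul ℝ (A x)]
  [FiberBundle F A] [VectorBundle ℝ F A]

theorem contMDiff_pairing (α : Form E F A) (X : Sec E F A) :
    ContMDiff 𝓘(ℝ, E) 𝓘(ℝ, ℝ) ∞ (fun x => α x (X x)) := by
  have h := α.contMDiff.clm_bundle_apply (E₂ := Bundle.Trivial M ℝ) (F₂ := ℝ) X.contMDiff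
  intro x
  exact ((contMDiffAt_section _).1 (h x))

variable (F A) in
/-- The identification of a fibre with the typical fibre. -/
noncomputable def fibreEquiv (x : M) : A x ≃L[ℝ] F :=
  (trivializationAt F A x).continuousLinearEquivAt ℝ x
    (FiberBundle.mem_baseSet_trivializationAt' x)

theorem eq_of_forall_dual_eq {V : Type*} [AddCommGroup V] [Module ℝ V] [TopologicalSpace V]
    (e : V ≃L[ℝ] F) {v w : V} (h : ∀ α : V →L[ℝ] ℝ, α v = α w) : v = w := by
  apply e.injective
  refine (SeparatingDual.eq_iff_forall_dual_eq (R := ℝ)).2 fun g => ?_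
  exact h (g.comp (e : V →L[ℝ] F))

namespace LieAlgebroid

variable (L : LieAlgebroid E F A)

/-- `d_A f` as a smooth form. -/
noncomputable def dForm (f : M → ℝ) (hf : ContMDiff 𝓘(ℝ, E) 𝓘(ℝ, ℝ) ∞ f) : Form E F A :=
  ⟨L.dA f, contMDiff_clm_bundle_comp (E₃ := Bundle.Trivial M ℝ) (F₃ := ℝ)
    (contMDiff_mvfderiv hf) L.anchor.contMDiff⟩

theorem dForm_apply (f : M → ℝ) (hf : ContMDiff 𝓘(ℝ, E) 𝓘(ℝ, ℝ) ∞ f) (x : M) :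
    L.dForm f hf x = L.dA f x := rfl

theorem dA_add {f g : M → ℝ} (hf : ContMDiff 𝓘(ℝ, E) 𝓘(ℝ, ℝ) ∞ f)
    (hg : ContMDiff 𝓘(ℝ, E) 𝓘(ℝ, ℝ) ∞ g) (x : M) (v : A x) :
    L.dA (fun y => f y + g y) x v = L.dA f x v + L.dA g x v := by
  have := mvfderiv_add (x := x) ((hf x).mdifferentiableAt (by simp))
    ((hg x).mdifferentiableAt (by simp))
  simp only [dA, ContinuousLinearMap.comp_apply]
  exact congrArg (fun T => T (L.anchor x v)) this

theorem dA_neg (f : M → ℝ) (x : M) (v : A x) :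
    L.dA (fun y => - f y) x v = - L.dA f x v := by
  simp only [dA, ContinuousLinearMap.comp_apply]
  exact congrArg (fun T => T (L.anchor x v)) (mvfderiv_neg (g := f) (x := x) (I := 𝓘(ℝ, E)))

/-- The function `X f = ρ(X) f` is smooth. -/
theorem contMDiff_dA_apply {f : M → ℝ} (hf : ContMDiff 𝓘(ℝ, E) 𝓘(ℝ, ℝ) ∞ f) (X : Sec E F A) :
    ContMDiff 𝓘(ℝ, E) 𝓘(ℝ, ℝ) ∞ (fun x => L.dA f x (X x)) :=
  contMDiff_pairing (L.dForm f hf) X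

/-- The defect of compatibility of `P` and `K`, evaluated on two forms and a section. -/
noncomputable def concomitant (P : TwoTensor E F A) (K : EndField E F A) (α β : Form E F A)
    (Z : Sec E F A) (x : M) : ℝ :=
  α x (L.lieEnd (P.sharp β) K Z x) - β x (L.lieEnd (P.sharp α) K Z x)
    + L.dA (fun y => β y (K y (P y (α y)))) x (Z x)
    - L.dA (fun y => β y (P y (α y))) x (K x (Z x))

variable {L} {P : TwoTensor E F A} {K K' : EndField E F A}

/-- `P^♯ K^* = K P^♯`. -/
def Intertwines (P : TwoTensor E F A) (K : EndField E F A) : Prop :=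
  ∀ (x : M) (α : A x →L[ℝ] ℝ), P x (α.comp (K x)) = K x (P x α)

theorem intertwines_of_isSkew (hP : IsSkew P) (hKP : IsSkew (fun x => (K x).comp (P x))) :
    Intertwines P K := by
  intro x α
  refine eq_of_forall_dual_eq (fibreEquiv F A x) fun β => ?_
  rw [hP, ContinuousLinearMap.comp_apply]
  exact (hKP x α β).symm

theorem Intertwines.isSkew (h : Intertwines P K) (hP : IsSkew P) :
    IsSkew (fun x => (K x).comp (P x)) := by
  intro x α β
  have := hP x α (β.comp (K x))
  rw [h] at this
  exact this

theorem Intertwines.sharp (h : Intertwines P K) (α : Form E F A) :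
    P.sharp (K.transpose α) = K.onSec (P.sharp α) :=
  ContMDiffSection.ext fun x => h x (α x)

theorem Intertwines.comp (h : Intertwines P K) (h' : Intertwines P K')
    (hc : K.comp K' = K'.comp K) : Intertwines P (K.comp K') := by
  intro x α
  have := h' x (α.comp (K x))
  rw [h] at this
  exact this.trans (congrArg (fun T : EndField E F A => T x (P x α)) hc.symm)

theorem Intertwines.add (h : Intertwines P K) (h' : Intertwines P K') :
    Intertwines P (K + K') := by
  intro x α
  have : α.comp ((K + K') x) = α.comp (K x) + α.comp (K' x) := ContinuousLinearMap.comp_add _ _ _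
  rw [this, map_add, h, h']
  rfl

theorem Intertwines.powerField [CompleteSpace F] {N : EndField E F A} (hN : Nondeg N)
    (h : Intertwines P N) (k : ℤ) : Intertwines P (powerField N hN k) := by
  have h1 : Intertwines P (PNAlgebroid.powerField N hN 1) := by rwa [powerField_one]
  have h2 : Intertwines P (PNAlgebroid.powerField N hN (-1)) := by
    intro x α
    have h0 := h1 x (α.comp (power N hN (-1) x))
    rw [powerField_apply, ContinuousLinearMap.comp_assoc, ← power_add, neg_add_cancel,
      power_zero] at h0
    change P x α = _ at h0
    rw [h0, powerField_apply, ← ContinuousLinearMap.comp_apply, ← power_add, neg_add_cancel,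
      power_zero]
    rfl
  induction k with
  | zero => rw [powerField_zero]; exact fun x α => rfl
  | succ k ih => rw [powerField_add]; exact ih.comp h1 (powerField_comp_comm _ _ _ _)
  | pred k ih =>
    rw [sub_eq_add_neg, powerField_add]; exact ih.comp h2 (powerField_comp_comm _ _ _ _)

/-- With `P^♯ K^* = K P^♯` the two brackets differ only by Lie derivatives of `K` along `P^♯ α` and
`P^♯ β` and by derivatives of the pairings; these terms form the concomitant. -/
theorem formBracket_comp (h : Intertwines P K) (α β : Form E F A) (Z : Sec E F A) (x : M) :
    L.formBracket (fun θ => K.onSec (P.sharp θ)) α β Z x =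
      L.deformedFormBracket P K α β Z x + L.concomitant P K α β Z x := by
  simp only [deformedFormBracket, formBracket, concomitant, lieDeriv, h.sharp, lieEnd]
  have h1 : ∀ X : Sec E F A, ∀ θ : Form E F A,
    (fun y => (K.transpose θ) y (X y)) = fun y => θ y (K y (X y)) := fun _ _ => rfl
  have h2 : ∀ x : M, ∀ θ : Form E F A, ∀ v,
    (K.transpose θ) x v = θ x (K x v) := fun _ _ _ => rfl
  have h3 : ∀ X : Sec E F A, ∀ x, K.onSec X x = K x (X x) := fun _ _ => rfl
  have h4 : ∀ θ : Form E F A, ∀ x, P.sharp θ x = P x (θ x) := fun _ _ => rfl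
  simp only [h2, h3, h4, ContMDiffSection.coe_sub, Pi.sub_apply, map_sub]
  ring

theorem concomitant_add (α β : Form E F A) (Z : Sec E F A) (x : M) :
    L.concomitant P (K + K') α β Z x =
      L.concomitant P K α β Z x + L.concomitant P K' α β Z x := by
  have h : L.dA (fun y => β y (K y (P y (α y))) + β y (K' y (P y (α y)))) x (Z x) =
      L.dA (fun y => β y (K y (P y (α y)))) x (Z x) +
        L.dA (fun y => β y (K' y (P y (α y)))) x (Z x) :=
    L.dA_add (contMDiff_pairing β (K.onSec (P.sharp α)))
      (contMDiff_pairing β (K'.onSec (P.sharp α))) x (Z x)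
  simp only [concomitant, lieEnd_add, ContMDiffSection.coe_add, Pi.add_apply, map_add, add_apply, h]
  ring

theorem concomitant_one (α β : Form E F A) (Z : Sec E F A) (x : M) :
    L.concomitant P (EndField.one E F A) α β Z x = 0 := by
  simp only [concomitant, lieEnd_one, ContMDiffSection.coe_zero, Pi.zero_apply, map_zero]
  simp [EndField.one]

/-- The derivation rule splits `ℒ(K K')`, heredity replaces `K ℒ_{P^♯ α} K'` by `ℒ_{P^♯ K^* α} K'`,
and the derivatives of the pairings telescope. -/
theorem concomitant_comp (h : L.Hereditary K K') (hK : Intertwines P K)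
    (hc : K.comp K' = K'.comp K) (α β : Form E F A) (Z : Sec E F A) (x : M) :
    L.concomitant P (K.comp K') α β Z x =
      L.concomitant P K α β (K'.onSec Z) x + L.concomitant P K' (K.transpose α) β Z x := by
  have h1 : ∀ X : Sec E F A, ∀ x, K'.onSec X x = K' x (X x) := fun _ _ => rfl
  have h1' : ∀ X : Sec E F A, ∀ x, K.onSec X x = K x (X x) := fun _ _ => rfl
  have h2 : ∀ y v, (K.comp K') y v = K y (K' y v) := fun _ _ => rfl
  have h3 : ∀ y v, K y (K' y v) = K' y (K y v) := fun y v =>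
    congrArg (fun T : EndField E F A => T y v) hc
  have h4 : ∀ y, (K.transpose α) y = (α y).comp (K y) := fun _ => rfl
  simp only [concomitant, lieEnd_comp, hK.sharp, h (P.sharp α) Z, ContMDiffSection.coe_add,
    Pi.add_apply, map_add, h1, h1', h2, h4, hK _ _, ContinuousLinearMap.comp_apply]
  simp only [h3]
  ring

theorem concomitant_powerField [CompleteSpace F] {N : EndField E F A} (hN : Nondeg N)
    (hNij : L.IsNijenhuis N) (hI : ∀ k, Intertwines P (powerField N hN k))
    (h : ∀ α β Z x, L.concomitant P N α β Z x = 0) (k : ℤ) (α β : Form E F A) (Z : Sec E F A)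
    (x : M) : L.concomitant P (powerField N hN k) α β Z x = 0 := by
  have hcomp : ∀ i j α β Z x, L.concomitant P (powerField N hN (i + j)) α β Z x =
      L.concomitant P (powerField N hN i) α β ((powerField N hN j).onSec Z) x +
      L.concomitant P (powerField N hN j) ((powerField N hN i).transpose α) β Z x := by
    intro i j α β Z x
    rw [powerField_add]
    exact concomitant_comp (hNij.hereditary_powerField hN i j) (hI i)
      (powerField_comp_comm N hN i j) α β Z x
  have h1 : ∀ α β Z x, L.concomitant P (powerField N hN 1) α β Z x = 0 := by
    rwa [powerField_one]
  have h2 : ∀ α β Z x, L.concomitant P (powerField N hN (-1)) α β Z x = 0 := by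
    intro α β Z x
    -- In the cocycle identity for `N N^{-1} = 1`, taken at `(N^{-1})^* α`, the form reaching the
    -- concomitant of `N^{-1}` is `α` itself.
    have hα : α = (powerField N hN 1).transpose ((powerField N hN (-1)).transpose α) := by
      refine ContMDiffSection.ext fun y => ?_
      change α y = ((α y).comp (power N hN (-1) y)).comp (power N hN 1 y)
      rw [ContinuousLinearMap.comp_assoc, ← power_add, neg_add_cancel, power_zero]
      rfl
    have h0 := hcomp 1 (-1) ((powerField N hN (-1)).transpose α) β Z x
    rw [add_neg_cancel, powerField_zero, concomitant_one, h1, zero_add, ← hα] at h0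
    exact h0.symm
  induction k generalizing α β Z x with
  | zero => rw [powerField_zero, concomitant_one]
  | succ k ih => rw [hcomp, ih, h1, add_zero]
  | pred k ih => rw [sub_eq_add_neg, hcomp, ih, h2, add_zero]

end LieAlgebroid

end Compatibility

/-! ### Global sections with prescribed values, and the anchor as a morphism -/

section Localisation

variable {E : Type*} [NormedAddCommGroup E] [NormedSpace ℝ E]
  {M : Type*} [TopologicalSpace M] [ChartedSpace E M] [IsManifold 𝓘(ℝ, E) ∞ M]
  {F : Type*} [NormedAddCommGroup F] [NormedSpace ℝ F]
  {A : M → Type*} [TopologicalSpace (TotalSpace F A)]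
  [∀ x, AddCommGroup (A x)] [∀ x, Module ℝ (A x)] [∀ x, TopologicalSpace (A x)]
  [∀ x, IsTopologicalAddGroup (A x)] [∀ x, ContinuousSMul ℝ (A x)]
  [FiberBundle F A] [VectorBundle ℝ F A]

open Topology in
theorem exists_contMDiff_cutoff [FiniteDimensional ℝ E] [T2Space M] {x : M} {U : Set M}
    (hU : U ∈ 𝓝 x) :
    ∃ χ : M → ℝ, ContMDiff 𝓘(ℝ, E) 𝓘(ℝ, ℝ) ∞ χ ∧ tsupport χ ⊆ U ∧ χ =ᶠ[𝓝 x] 1 := by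
  obtain ⟨f, -, hf⟩ := (SmoothBumpFunction.nhds_basis_tsupport (I := 𝓘(ℝ, E)) x).mem_iff.1 hU
  exact ⟨f, f.contMDiff, hf, f.eventuallyEq_one⟩

variable [ContMDiffVectorBundle ∞ F A 𝓘(ℝ, E)]

variable (F A) in
/-- The section that is constant with value `v` in the trivialization at `x`, cut off by `χ`. -/
noncomputable def cutoffSec (x : M) {χ : M → ℝ} (hχ : ContMDiff 𝓘(ℝ, E) 𝓘(ℝ, ℝ) ∞ χ)
    (hs : tsupport χ ⊆ (trivializationAt F A x).baseSet) (v : F) : Sec E F A :=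
  ⟨fun y => χ y • (trivializationAt F A x).symmL ℝ y v, by
    refine ContMDiffOn.smul_section_of_tsupport (s := fun y => (trivializationAt F A x).symmL ℝ y v)
      hχ.contMDiffOn (trivializationAt F A x).open_baseSet hs ?_
    have h := ((trivializationAt F A x).contMDiffOn_symm (IB := 𝓘(ℝ, E)) (n := ∞)).comp
      (s := (trivializationAt F A x).baseSet)
      ((contMDiff_id (I := 𝓘(ℝ, E)) (M := M)).prodMk
        (contMDiff_const (c := v) (I' := 𝓘(ℝ, F)))).contMDiffOn
      (fun y hy => by simpa [(trivializationAt F A x).mem_target] using hy)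
    refine h.congr fun y hy => ?_
    rw [(trivializationAt F A x).symmL_apply hy]
    exact (trivializationAt F A x).mk_symm hy v⟩

theorem exists_sec_apply_eq [FiniteDimensional ℝ E] [T2Space M] (x : M) (v : A x) :
    ∃ X : Sec E F A, X x = v := by
  have hx := FiberBundle.mem_baseSet_trivializationAt' (F := F) (E := A) x
  obtain ⟨χ, hχ, hs, h1⟩ := exists_contMDiff_cutoff (E := E)
    ((trivializationAt F A x).open_baseSet.mem_nhds hx)
  refine ⟨cutoffSec F A x hχ hs ((trivializationAt F A x) ⟨x, v⟩).2, ?_⟩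
  change χ x • (trivializationAt F A x).symmL ℝ x _ = v
  rw [h1.eq_of_nhds, Pi.one_apply, one_smul, (trivializationAt F A x).symmL_apply hx]
  exact (trivializationAt F A x).symm_apply_apply_mk hx v

namespace LieAlgebroid

variable (L : LieAlgebroid E F A)

theorem bracket_fsmul (X Y : Sec E F A) {f : M → ℝ} (hf : ContMDiff 𝓘(ℝ, E) 𝓘(ℝ, ℝ) ∞ f) :
    L.bracket X (fsmul f hf Y) =
      fsmul f hf (L.bracket X Y) + fsmul _ (L.contMDiff_dA_apply hf X) Y :=
  ContMDiffSection.ext fun x => L.leibniz X Y f hf x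

/-- The anchor is a morphism of Lie algebras. -/
theorem dA_bracket [FiniteDimensional ℝ E] [T2Space M] (X Y : Sec E F A) {f : M → ℝ}
    (hf : ContMDiff 𝓘(ℝ, E) 𝓘(ℝ, ℝ) ∞ f) (x : M) :
    L.dA f x (L.bracket X Y x) =
      L.dA (fun y => L.dA f y (Y y)) x (X x) - L.dA (fun y => L.dA f y (X y)) x (Y x) := by
  -- Subtracting `f` times the Jacobi identity for `X, Y, Z` from the one for `X, Y, fZ` leaves the
  -- claim multiplied by `Z x`, so `Z x ≠ 0` is needed. On a zero fibre both sides vanish.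
  by_cases hA : ∃ v : A x, v ≠ 0
  · obtain ⟨v, hv⟩ := hA
    obtain ⟨Z, rfl⟩ := exists_sec_apply_eq (E := E) (F := F) x v
    have hj := congrArg (fun S : Sec E F A => S x) (L.jacobi X Y (fsmul f hf Z))
    have hj' := congrArg (fun S : Sec E F A => f x • S x) (L.jacobi X Y Z)
    simp only [L.bracket_skew (fsmul f hf Z) X, L.bracket_skew (fsmul f hf Z) (L.bracket X Y),
      L.bracket_skew Z X, L.bracket_skew Z (L.bracket X Y), bracket_neg_right] at hj hj'
    simp only [bracket_fsmul, bracket_add_right] at hj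
    simp only [ContMDiffSection.coe_add, ContMDiffSection.coe_neg, Pi.add_apply, Pi.neg_apply,
      fsmul, ContMDiffSection.coeFn_mk, ContMDiffSection.coe_zero, Pi.zero_apply] at hj hj'
    rw [← sub_eq_zero, ← smul_eq_zero_iff_left hv]
    linear_combination (norm := module) hj' - hj
  · push Not at hA
    simp [hA]

end LieAlgebroid

end Localisation

/-! ### Poisson structures induced on the base -/

section Poisson

variable {E : Type*} [NormedAddCommGroup E] [NormedSpace ℝ E]
  {M : Type*} [TopologicalSpace M] [ChartedSpace E M] [IsManifold 𝓘(ℝ, E) ∞ M]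
  {F : Type*} [NormedAddCommGroup F] [NormedSpace ℝ F]
  {A : M → Type*} [TopologicalSpace (TotalSpace F A)]
  [∀ x, AddCommGroup (A x)] [∀ x, Module ℝ (A x)] [∀ x, TopologicalSpace (A x)]
  [∀ x, IsTopologicalAddGroup (A x)] [∀ x, ContinuousSMul ℝ (A x)]
  [FiberBundle F A] [VectorBundle ℝ F A]

namespace LieAlgebroid

variable {L : LieAlgebroid E F A} {P : TwoTensor E F A} {K : EndField E F A}

/-- The sharp map of a Poisson structure is a morphism of brackets:
`⟨γ, P^♯ [α, β]_P⟩ = ⟨γ, [P^♯ α, P^♯ β]⟩`. -/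
theorem IsPoisson.formBracket_sharp (hP : L.IsPoisson P) (α β γ : Form E F A) (x : M) :
    L.formBracket P.sharp α β (P.sharp γ) x =
      - γ x (L.bracket (P.sharp α) (P.sharp β) x) := by
  have h := hP.schouten_eq_zero α β γ x
  have hs : ∀ θ η : Form E F A,
      L.dA (fun y => θ y (P y (η y))) x = - L.dA (fun y => η y (P y (θ y))) x := by
    intro θ η
    ext v
    rw [neg_apply, ← L.dA_neg]
    exact congrArg (fun f => L.dA f x v) (funext fun y => hP.skew y (η y) (θ y))
  have h4 : ∀ θ : Form E F A, ∀ x, P.sharp θ x = P x (θ x) := fun _ _ => rfl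
  -- By skewness of `P`, the Schouten bracket is twice the difference of the two sides.
  simp only [schoutenSelf, formBracket, lieDeriv, h4, L.bracket_skew (P.sharp β) (P.sharp α),
    L.bracket_skew (P.sharp γ) (P.sharp α), L.bracket_skew (P.sharp γ) (P.sharp β),
    ContMDiffSection.coe_neg, Pi.neg_apply, map_neg, hs β α, hs γ α, hs γ β, neg_apply] at h ⊢
  linarith

/-- Since `K P^♯ γ = P^♯ K^* γ`, the morphism property of `P^♯` applies to each term of the deformed
bracket. Together they give `-γ(K [P^♯ α, P^♯ β]_K)`, and the Nijenhuis identity finishes. -/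
theorem IsPoisson.formBracket_comp_sharp (hP : L.IsPoisson P) (hI : Intertwines P K)
    (hK : L.IsNijenhuis K) (hc : ∀ α β Z x, L.concomitant P K α β Z x = 0)
    (α β γ : Form E F A) (x : M) :
    L.formBracket (fun θ => K.onSec (P.sharp θ)) α β (K.onSec (P.sharp γ)) x =
      - γ x (L.bracket (K.onSec (P.sharp α)) (K.onSec (P.sharp β)) x) := by
  rw [formBracket_comp hI, hc, add_zero, deformedFormBracket, ← hI.sharp γ,
    hP.formBracket_sharp, hP.formBracket_sharp, ← hI.sharp (K.transpose γ),
    hP.formBracket_sharp, ← hK, hI.sharp, hI.sharp]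
  have h : ∀ θ : Form E F A, ∀ X : Sec E F A, K.transpose θ x (X x) = θ x (K.onSec X x) :=
    fun _ _ => rfl
  simp only [h, deformed, EndField.onSec_add, EndField.onSec_sub, ContMDiffSection.coe_add,
    ContMDiffSection.coe_sub, Pi.add_apply, Pi.sub_apply, map_add, map_sub]
  ring

variable [ContMDiffVectorBundle ∞ F A 𝓘(ℝ, E)] [FiniteDimensional ℝ E] [T2Space M]

theorem lieDeriv_dForm (X Z : Sec E F A) {f : M → ℝ} (hf : ContMDiff 𝓘(ℝ, E) 𝓘(ℝ, ℝ) ∞ f)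
    (x : M) : L.lieDeriv X (L.dForm f hf) Z x = L.dA (fun y => L.dA f y (X y)) x (Z x) := by
  simp only [lieDeriv, dForm_apply, L.dA_bracket X Z hf]
  ring

variable (L P K) in
/-- The tensor on the base with sharp map `ρ ∘ K P^♯ ∘ ρ^*`. -/
noncomputable def baseTensor (x : M) :
    (TangentSpace 𝓘(ℝ, E) x →L[ℝ] ℝ) →L[ℝ] TangentSpace 𝓘(ℝ, E) x :=
  ((L.anchor x).comp ((K x).comp (P x))).comp (ContinuousLinearMap.precomp ℝ (L.anchor x))

/-- For exact forms `ℒ_X d_A f = d_A (X f)`, so every term of the morphism property becomes an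
iterated bracket of `f`, `g`, `h`. -/
theorem jacobi_baseTensor (hP : L.IsPoisson P) (hI : Intertwines P K)
    (hK : L.IsNijenhuis K) (hc : ∀ α β Z x, L.concomitant P K α β Z x = 0) {f g h : M → ℝ}
    (hf : ContMDiff 𝓘(ℝ, E) 𝓘(ℝ, ℝ) ∞ f) (hg : ContMDiff 𝓘(ℝ, E) 𝓘(ℝ, ℝ) ∞ g)
    (hh : ContMDiff 𝓘(ℝ, E) 𝓘(ℝ, ℝ) ∞ h) (x : M) :
    pbracket (L.baseTensor P K) f (pbracket (L.baseTensor P K) g h) x +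
      pbracket (L.baseTensor P K) g (pbracket (L.baseTensor P K) h f) x +
      pbracket (L.baseTensor P K) h (pbracket (L.baseTensor P K) f g) x = 0 := by
  have key := hP.formBracket_comp_sharp hI hK hc (L.dForm f hf) (L.dForm g hg) (L.dForm h hh) x
  have hskew : ∀ u v : M → ℝ, ∀ y, L.dA u y (K y (P y (L.dA v y))) =
      - L.dA v y (K y (P y (L.dA u y))) := fun u v y => hI.isSkew hP.skew y _ _
  have h4 : ∀ u (hu : ContMDiff 𝓘(ℝ, E) 𝓘(ℝ, ℝ) ∞ u), ∀ y,
    K.onSec (P.sharp (L.dForm u hu)) y = K y (P y (L.dA u y)) := fun _ _ _ => rfl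
  have hneg : L.dA (fun y => L.dA f y (K y (P y (L.dA h y)))) x =
      - L.dA (fun y => L.dA h y (K y (P y (L.dA f y)))) x := by
    ext v
    rw [neg_apply, ← L.dA_neg]
    exact congrArg (fun f => L.dA f x v) (funext fun y => hskew _ _ _)
  have hneg' : L.dA (fun y => L.dA f y (K y (P y (L.dA g y)))) x =
      - L.dA (fun y => L.dA g y (K y (P y (L.dA f y)))) x := by
    ext v
    rw [neg_apply, ← L.dA_neg]
    exact congrArg (fun f => L.dA f x v) (funext fun y => hskew _ _ _)
  simp only [formBracket, lieDeriv_dForm, dForm_apply, L.dA_bracket _ _ hh, h4, hneg', neg_apply]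
    at key
  have e : ∀ u v : M → ℝ, pbracket (L.baseTensor P K) u v =
    fun x => L.dA v x (K x (P x (L.dA u x))) := fun _ _ => rfl
  simp only [e, hneg, neg_apply]
  linarith

theorem isPoissonStructure_baseTensor (hP : L.IsPoisson P) (hI : Intertwines P K)
    (hK : L.IsNijenhuis K) (hc : ∀ α β Z x, L.concomitant P K α β Z x = 0) :
    IsPoissonStructure (L.baseTensor P K) where
  smooth := contMDiff_clm_bundle_comp (contMDiff_clm_bundle_comp L.anchor.contMDiff
    (contMDiff_clm_bundle_comp K.contMDiff P.contMDiff)) (contMDiff_precomp L.anchor.contMDiff)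
  skew := fun x α β => hI.isSkew hP.skew x (α.comp (L.anchor x)) (β.comp (L.anchor x))
  jacobi := fun _ _ _ hf hg hh x => jacobi_baseTensor hP hI hK hc hf hg hh x

variable [CompleteSpace F] {N : EndField E F A}

theorem IsPN.intertwines (h : L.IsPN P N) : Intertwines P N :=
  intertwines_of_isSkew h.poisson.skew h.skew

theorem IsPN.concomitant_eq_zero (h : L.IsPN P N) (α β : Form E F A) (Z : Sec E F A) (x : M) :
    L.concomitant P N α β Z x = 0 := by
  have h1 := formBracket_comp (L := L) h.intertwines α β Z x
  rw [h.bracket_eq] at h1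
  linarith

theorem IsPN.isPoissonStructure_basePoisson (h : L.IsPN P N) (hN : Nondeg N) (j : ℤ) :
    IsPoissonStructure (L.basePoisson P N hN j) :=
  isPoissonStructure_baseTensor (K := powerField N hN j) h.poisson (h.intertwines.powerField hN j)
    (h.nijenhuis.hereditary_powerField hN j j).isNijenhuis
    (concomitant_powerField hN h.nijenhuis (h.intertwines.powerField hN) h.concomitant_eq_zero j)

theorem IsPN.isCompatible_basePoisson (h : L.IsPN P N) (hN : Nondeg N) (i j : ℤ) :
    IsCompatible (L.basePoisson P N hN i) (L.basePoisson P N hN j) where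
  left := h.isPoissonStructure_basePoisson hN i
  right := h.isPoissonStructure_basePoisson hN j
  sum := by
    have hp := fun k => h.intertwines.powerField hN k
    have hh := h.nijenhuis.hereditary_powerField hN
    have hc := concomitant_powerField hN h.nijenhuis hp h.concomitant_eq_zero
    -- The sum of the two tensors belongs to `K = N^i + N^j`, which need not be invertible.
    have := isPoissonStructure_baseTensor (K := powerField N hN i + powerField N hN j) h.poisson
      ((hp i).add (hp j))
      (((hh i i).add_right (hh i j)).add_left ((hh j i).add_right (hh j j))).isNijenhuis
      (fun α β Z x => by rw [concomitant_add, hc, hc, add_zero])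
    refine (congrArg IsPoissonStructure (funext fun x => ?_)).mp this
    ext α
    exact map_add (L.anchor x) _ _

end LieAlgebroid

end Poisson

/-! ### Derivatives of integer powers in a normed ring -/

section UnitPower

variable {R : Type*} [NormedRing R]

open Classical in
/-- The integer power of an element of a ring, with value `0` at the non-units. -/
noncomputable def unitPow (k : ℤ) (T : R) : R := if h : IsUnit T then ↑(h.unit ^ k) else 0

theorem unitPow_coe (k : ℤ) (u : Rˣ) : unitPow k (u : R) = ↑(u ^ k) := by
  rw [unitPow, dif_pos u.isUnit, IsUnit.unit_of_val_units]

variable [NormedAlgebra ℝ R] [HasSummableGeomSeries R]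

-- The units form an open set, so the default value of `unitPow` at non-units does not affect
-- derivatives at a unit.
open Topology in
theorem eventuallyEq_of_units {S : Type*} {f g : R → S} (u : Rˣ) (h : ∀ v : Rˣ, f v = g v) :
    f =ᶠ[𝓝 (u : R)] g := by
  filter_upwards [Units.nhds u] with T hT
  obtain ⟨v, rfl⟩ := hT
  exact h v

theorem contDiffAt_unitPow (k : ℤ) (u : Rˣ) : ContDiffAt ℝ ∞ (unitPow k) (u : R) := by
  induction k with
  | zero =>
    refine (contDiffAt_const (c := (1 : R))).congr_of_eventuallyEq
      (eventuallyEq_of_units u fun v => ?_)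
    simp [unitPow_coe]
  | succ k ih =>
    refine (ih.mul contDiffAt_id).congr_of_eventuallyEq (eventuallyEq_of_units u fun v => ?_)
    simp [unitPow_coe, zpow_add_one]
  | pred k ih =>
    refine (ih.mul (contDiffAt_ringInverse ℝ u)).congr_of_eventuallyEq
      (eventuallyEq_of_units u fun v => ?_)
    simp [unitPow_coe, zpow_sub_one]

theorem fderiv_unitPow_add_one (k : ℤ) (u : Rˣ) (S : R) :
    fderiv ℝ (unitPow (k + 1)) (u : R) S =
      fderiv ℝ (unitPow k) (u : R) S * u + ↑(u ^ k) * S := by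
  have h : unitPow (k + 1) =ᶠ[nhds (u : R)] fun T => unitPow k T * T :=
    eventuallyEq_of_units u fun v => by simp [unitPow_coe, zpow_add_one]
  have hd := ((contDiffAt_unitPow k u).differentiableAt (by simp)).hasFDerivAt
  have hm := hd.mul' (hasFDerivAt_id (𝕜 := ℝ) (u : R))
  rw [h.fderiv_eq]
  refine (congrArg (fun f => f S) hm.fderiv).trans ?_
  simp [add_comm, unitPow_coe]

/-- The factor `u^m` is there for the induction: the product rule leaves a `u` on the right, which
cyclicity of `t` moves to the left, raising `m` by one. -/
theorem trace_mul_fderiv_unitPow {t : R →ₗ[ℝ] ℝ} (ht : ∀ a b, t (a * b) = t (b * a)) (k m : ℤ)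
    (u : Rˣ) (S : R) :
    t (↑(u ^ m) * fderiv ℝ (unitPow k) (u : R) S) = k * t (↑(u ^ (m + k - 1)) * S) := by
  have hstep : ∀ k m : ℤ, t (↑(u ^ m) * fderiv ℝ (unitPow (k + 1)) (u : R) S) =
      t (↑(u ^ (m + 1)) * fderiv ℝ (unitPow k) (u : R) S) + t (↑(u ^ (m + k)) * S) := by
    intro k m
    rw [fderiv_unitPow_add_one, mul_add, map_add, ← mul_assoc, ht, ← mul_assoc, ← mul_assoc,
      add_comm m 1, zpow_add, zpow_add, zpow_one, Units.val_mul, Units.val_mul]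
  induction k generalizing m with
  | zero =>
    have h : unitPow 0 =ᶠ[nhds (u : R)] fun _ => 1 :=
      eventuallyEq_of_units u fun v => by simp [unitPow_coe]
    simp [h.fderiv_eq]
  | succ k ih =>
    rw [hstep, ih, show m + 1 + (k : ℤ) - 1 = m + k by ring,
      show m + ((k : ℤ) + 1) - 1 = m + k by ring]
    push_cast
    ring
  | pred k ih =>
    -- The recursion is solved for its lower power; starting at `m - 1` makes the shifted exponent
    -- equal to `m`.
    have h := hstep (-(k : ℤ) - 1) (m - 1)
    rw [sub_add_cancel, ih, sub_add_cancel, show m - 1 + -(k : ℤ) - 1 = m + (-k - 1) - 1 by ring,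
      show m - 1 + (-(k : ℤ) - 1) = m + (-k - 1) - 1 by ring] at h
    push_cast at h ⊢
    linarith

end UnitPower

/-! ### The functions `h_i` on the endomorphisms of a vector space -/

section Model

variable {F : Type*} [NormedAddCommGroup F] [NormedSpace ℝ F] [FiniteDimensional ℝ F]

variable (F) in
/-- The trace on the continuous endomorphisms. -/
noncomputable def traceCLM : (F →L[ℝ] F) →L[ℝ] ℝ :=
  LinearMap.toContinuousLinearMap (LinearMap.trace ℝ F ∘ₗ ContinuousLinearMap.coeLM ℝ)

theorem traceCLM_apply (T : F →L[ℝ] F) : traceCLM F T = LinearMap.trace ℝ F (T : F →ₗ[ℝ] F) := rfl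

theorem traceCLM_mul_comm (S T : F →L[ℝ] F) : traceCLM F (S * T) = traceCLM F (T * S) :=
  LinearMap.trace_mul_comm ℝ (S : F →ₗ[ℝ] F) (T : F →ₗ[ℝ] F)

variable (F) in
/-- The determinant on the continuous endomorphisms. -/
noncomputable def detHom : (F →L[ℝ] F) →* ℝ where
  toFun T := LinearMap.det (T : F →ₗ[ℝ] F)
  map_one' := LinearMap.det_id
  map_mul' S T := LinearMap.det_comp (S : F →ₗ[ℝ] F) (T : F →ₗ[ℝ] F)

theorem detHom_apply (T : F →L[ℝ] F) : detHom F T = LinearMap.det (T : F →ₗ[ℝ] F) := rfl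

theorem contDiff_detHom : ContDiff ℝ ∞ (detHom F) := by
  let b := Module.finBasis ℝ F
  have h : (detHom F : (F →L[ℝ] F) → ℝ) =
      fun T : F →L[ℝ] F => Matrix.det (LinearMap.toMatrix b b (T : F →ₗ[ℝ] F)) :=
    funext fun T => (LinearMap.det_toMatrix b _).symm
  rw [h]
  simp only [Matrix.det_apply]
  refine ContDiff.sum fun σ _ => ContDiff.const_smul _ (contDiff_prod fun i _ => ?_)
  let ℓ : (F →L[ℝ] F) →ₗ[ℝ] ℝ :=
    Matrix.entryLinearMap ℝ ℝ (σ i) i ∘ₗ (LinearMap.toMatrix b b).toLinearMap ∘ₗ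
      ContinuousLinearMap.coeLM ℝ
  exact (LinearMap.toContinuousLinearMap ℓ).contDiff

/-- The linear coefficient of the polynomial `det(1 + X B)` is the trace of `B`. -/
theorem hasDerivAt_detHom_one_add_smul (S : F →L[ℝ] F) :
    HasDerivAt (fun s : ℝ => detHom F (1 + s • S)) (traceCLM F S) 0 := by
  let b := Module.finBasis ℝ F
  let B := LinearMap.toMatrix b b (S : F →ₗ[ℝ] F)
  have hB := Matrix.derivative_det_one_add_X_smul B
  have h1 : traceCLM F S = B.trace := by
    rw [traceCLM_apply, LinearMap.trace_eq_matrix_trace ℝ b]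
  rw [h1, ← hB]
  refine (Polynomial.hasDerivAt _ 0).congr_of_eventuallyEq (Filter.Eventually.of_forall fun s => ?_)
  have h2 : LinearMap.toMatrix b b ((1 + s • S : F →L[ℝ] F) : F →ₗ[ℝ] F) = 1 + s • B := by
    have : ((1 + s • S : F →L[ℝ] F) : F →ₗ[ℝ] F) = LinearMap.id + s • (S : F →ₗ[ℝ] F) := rfl
    rw [this, map_add, map_smul, LinearMap.toMatrix_id]
  change detHom F (1 + s • S) = _
  rw [detHom_apply, ← LinearMap.det_toMatrix b, h2, ← Polynomial.coe_evalRingHom,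
    RingHom.map_det]
  congr 1
  ext i j
  simpa [Matrix.one_apply, apply_ite] using mul_comm _ _

/-- Multiplicativity reduces to the identity, since `u + s S = u (1 + s u⁻¹ S)`. -/
theorem fderiv_detHom_unit (u : (F →L[ℝ] F)ˣ) (S : F →L[ℝ] F) :
    fderiv ℝ (detHom F) (u : F →L[ℝ] F) S =
      detHom F u * traceCLM F ((↑u⁻¹ : F →L[ℝ] F) * S) := by
  have hd := ((contDiff_detHom (F := F)).differentiable (by simp) (u : F →L[ℝ] F)).hasFDerivAt
  have h1 := hd.comp_hasDerivAt_of_eq (0 : ℝ) (((hasDerivAt_id (0 : ℝ)).smul_const S).const_add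
    (u : F →L[ℝ] F)) (by simp)
  have h2 := (hasDerivAt_detHom_one_add_smul ((↑u⁻¹ : F →L[ℝ] F) * S)).const_mul (detHom F u)
  rw [one_smul] at h1
  refine h1.unique (h2.congr_of_eventuallyEq (Filter.Eventually.of_forall fun s => ?_))
  simp only [Function.comp_apply, id]
  rw [← map_mul, mul_add, mul_one, mul_smul_comm, Units.mul_inv_cancel_left]

theorem detHom_unit_ne_zero (u : (F →L[ℝ] F)ˣ) : detHom F u ≠ 0 :=
  (u.isUnit.map (detHom F)).ne_zero

/-- The functions `h_i` on the endomorphisms of a vector space. -/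
noncomputable def modelHam (i : ℤ) (T : F →L[ℝ] F) : ℝ :=
  if i = 0 then Real.log (detHom F T)
  else (1 / (i : ℝ)) * traceCLM F (unitPow i T)

theorem modelHam_zero : modelHam 0 = fun T : F →L[ℝ] F => Real.log (detHom F T) :=
  funext fun _ => if_pos rfl

theorem modelHam_of_ne_zero {i : ℤ} (hi : i ≠ 0) :
    modelHam i = fun T : F →L[ℝ] F => (1 / (i : ℝ)) * traceCLM F (unitPow i T) :=
  funext fun _ => if_neg hi

theorem contDiffAt_modelHam (i : ℤ) (u : (F →L[ℝ] F)ˣ) :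
    ContDiffAt ℝ ∞ (modelHam i) (u : F →L[ℝ] F) := by
  by_cases hi : i = 0
  · rw [hi, modelHam_zero]
    exact (contDiff_detHom.contDiffAt).log (detHom_unit_ne_zero u)
  · rw [modelHam_of_ne_zero hi]
    exact contDiffAt_const.mul
      ((traceCLM F).contDiff.contDiffAt.comp _ (contDiffAt_unitPow i u))

/-- The factor `1 / i` and the logarithm at `i = 0` are chosen so that one formula covers all `i`.
-/
theorem fderiv_modelHam (i : ℤ) (u : (F →L[ℝ] F)ˣ) (S : F →L[ℝ] F) :
    fderiv ℝ (modelHam i) (u : F →L[ℝ] F) S =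
      traceCLM F ((↑(u ^ (i - 1)) : F →L[ℝ] F) * S) := by
  by_cases hi : i = 0
  · have hd := ((contDiff_detHom (F := F)).differentiable (by simp) (u : F →L[ℝ] F)).hasFDerivAt
    rw [hi, modelHam_zero, (hd.log (detHom_unit_ne_zero u)).fderiv, smul_apply,
      fderiv_detHom_unit, smul_eq_mul, inv_mul_cancel_left₀ (detHom_unit_ne_zero u), zero_sub,
      zpow_neg_one]
  · have hd := ((contDiffAt_unitPow i u).differentiableAt (by simp)).hasFDerivAt
    have h := trace_mul_fderiv_unitPow (t := (traceCLM F).toLinearMap)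
      traceCLM_mul_comm i 0 u S
    have hc := ((traceCLM F).hasFDerivAt.comp (u : F →L[ℝ] F) hd).const_mul (1 / (i : ℝ))
    rw [modelHam_of_ne_zero hi]
    refine (congrArg (fun f => f S) hc.fderiv).trans ?_
    simp only [zpow_zero, Units.val_one, one_mul, zero_add, ContinuousLinearMap.coe_coe] at h
    have hi' : (i : ℝ) ≠ 0 := by exact_mod_cast hi
    rw [smul_apply, ContinuousLinearMap.comp_apply, h, smul_eq_mul, ← mul_assoc,
      one_div_mul_cancel hi', one_mul]

end Model

/-! ### The functions `h_i` on the base and their differentials -/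

section Trace

variable {E : Type*} [NormedAddCommGroup E] [NormedSpace ℝ E]
  {M : Type*} [TopologicalSpace M] [ChartedSpace E M] [IsManifold 𝓘(ℝ, E) ∞ M]
  {F : Type*} [NormedAddCommGroup F] [NormedSpace ℝ F]
  {A : M → Type*} [TopologicalSpace (TotalSpace F A)]
  [∀ x, AddCommGroup (A x)] [∀ x, Module ℝ (A x)] [∀ x, TopologicalSpace (A x)]
  [∀ x, IsTopologicalAddGroup (A x)] [∀ x, ContinuousSMul ℝ (A x)]
  [FiberBundle F A] [VectorBundle ℝ F A]

/-- The bundle map `N` in the trivialization at `x₀`. -/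
noncomputable def EndField.coord (N : EndField E F A) (x₀ x : M) : F →L[ℝ] F :=
  ContinuousLinearMap.inCoordinates F A F A x₀ x x₀ x (N x)

theorem EndField.coord_apply (N : EndField E F A) {x₀ x : M}
    (hx : x ∈ (trivializationAt F A x₀).baseSet) (v : F) :
    N.coord x₀ x v =
      (trivializationAt F A x₀ ⟨x, N x ((trivializationAt F A x₀).symm x v)⟩).2 := by
  simp [coord, ContinuousLinearMap.inCoordinates, hx]

theorem EndField.symm_coord (N : EndField E F A) {x₀ x : M}
    (hx : x ∈ (trivializationAt F A x₀).baseSet) (v : F) :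
    (trivializationAt F A x₀).symm x (N.coord x₀ x v) =
      N x ((trivializationAt F A x₀).symm x v) := by
  rw [N.coord_apply hx]
  exact (trivializationAt F A x₀).symm_apply_apply_mk hx _

/-- The unit that represents a nondegenerate bundle map at a point. -/
noncomputable def coordUnit (N : EndField E F A) (hN : Nondeg N) {x₀ x : M}
    (hx : x ∈ (trivializationAt F A x₀).baseSet) : (F →L[ℝ] F)ˣ :=
  Units.map (inCoordinatesHom hx) (hN x).unit

theorem coordUnit_val (N : EndField E F A) (hN : Nondeg N) {x₀ x : M}
    (hx : x ∈ (trivializationAt F A x₀).baseSet) :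
    (coordUnit N hN hx : F →L[ℝ] F) = N.coord x₀ x := rfl

theorem trace_inCoordinates {x₀ x : M} (hx : x ∈ (trivializationAt F A x₀).baseSet)
    (T : A x →L[ℝ] A x) :
    LinearMap.trace ℝ F (ContinuousLinearMap.inCoordinates F A F A x₀ x x₀ x T : F →ₗ[ℝ] F) =
      LinearMap.trace ℝ (A x) (T : A x →ₗ[ℝ] A x) := by
  rw [← LinearMap.trace_conj' (T : A x →ₗ[ℝ] A x)
    ((trivializationAt F A x₀).continuousLinearEquivAt ℝ x hx).toLinearEquiv,
    ContinuousLinearMap.inCoordinates_eq hx hx]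
  rfl

theorem det_inCoordinates {x₀ x : M} (hx : x ∈ (trivializationAt F A x₀).baseSet)
    (T : A x →L[ℝ] A x) :
    LinearMap.det (ContinuousLinearMap.inCoordinates F A F A x₀ x x₀ x T : F →ₗ[ℝ] F) =
      LinearMap.det (T : A x →ₗ[ℝ] A x) := by
  rw [← LinearMap.det_conj (T : A x →ₗ[ℝ] A x)
    ((trivializationAt F A x₀).continuousLinearEquivAt ℝ x hx).toLinearEquiv,
    ContinuousLinearMap.inCoordinates_eq hx hx]
  rfl

section Functions

variable [FiniteDimensional ℝ F] (N : EndField E F A) (hN : Nondeg N)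

theorem hamFun_eq_modelHam {x₀ x : M} (hx : x ∈ (trivializationAt F A x₀).baseSet) (i : ℤ) :
    hamFun N hN i x = modelHam i (N.coord x₀ x) := by
  rw [hamFun, modelHam]
  congr 1
  · rw [detHom_apply, EndField.coord, det_inCoordinates hx]
  · rw [← coordUnit_val N hN hx, unitPow_coe, coordUnit, ← map_zpow, traceCLM_apply]
    exact congrArg _ (trace_inCoordinates hx _).symm

open Topology in
theorem hamFun_eventuallyEq (x : M) (i : ℤ) :
    hamFun N hN i =ᶠ[𝓝 x] modelHam i ∘ N.coord x := by
  filter_upwards [(trivializationAt F A x).open_baseSet.mem_nhds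
    (FiberBundle.mem_baseSet_trivializationAt' x)] with y hy
  exact hamFun_eq_modelHam N hN hy i

theorem EndField.contMDiffAt_coord (N : EndField E F A) [ContMDiffVectorBundle ∞ F A 𝓘(ℝ, E)]
    {x₀ x : M} (hx : x ∈ (trivializationAt F A x₀).baseSet) :
    ContMDiffAt 𝓘(ℝ, E) 𝓘(ℝ, F →L[ℝ] F) ∞ (N.coord x₀) x := by
  have h := ((trivializationAt (F →L[ℝ] F) (fun x : M => A x →L[ℝ] A x) x₀).contMDiffAt_section_iff
    (IB := 𝓘(ℝ, E)) (n := ∞) (s := fun y => N y) (x₀ := x) (by simpa using hx)).1 (N.contMDiff x)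
  exact h

theorem contMDiff_hamFun [ContMDiffVectorBundle ∞ F A 𝓘(ℝ, E)] (i : ℤ) :
    ContMDiff 𝓘(ℝ, E) 𝓘(ℝ, ℝ) ∞ (hamFun N hN i) := by
  intro x
  have hx := FiberBundle.mem_baseSet_trivializationAt' (F := F) (E := A) x
  exact ((contDiffAt_modelHam i (coordUnit N hN hx)).contMDiffAt.comp x
    (N.contMDiffAt_coord hx)).congr_of_eventuallyEq (hamFun_eventuallyEq N hN x i)

theorem mvfderiv_hamFun [ContMDiffVectorBundle ∞ F A 𝓘(ℝ, E)] (i : ℤ) (x : M)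
    (w : TangentSpace 𝓘(ℝ, E) x) :
    mvfderiv 𝓘(ℝ, E) (hamFun N hN i) x w = traceCLM F
      ((↑(coordUnit N hN (FiberBundle.mem_baseSet_trivializationAt' x) ^ (i - 1)) : F →L[ℝ] F) *
        mvfderiv 𝓘(ℝ, E) (N.coord x) x w) := by
  have hx := FiberBundle.mem_baseSet_trivializationAt' (F := F) (E := A) x
  have h1 : mvfderiv 𝓘(ℝ, E) (hamFun N hN i) x =
      mvfderiv 𝓘(ℝ, E) (modelHam i ∘ N.coord x) x := by
    simp only [mvfderiv, (hamFun_eventuallyEq N hN x i).mfderiv_eq]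
    rfl
  have hd := contDiffAt_modelHam i (coordUnit N hN hx)
  rw [h1, mvfderiv_comp_apply x (hd.contMDiffAt.mdifferentiableAt (by simp))
    ((N.contMDiffAt_coord hx).mdifferentiableAt (by simp)), ← fderiv_modelHam, mvfderiv, mfderiv_eq_fderiv]
  rfl

end Functions

end Trace

/-! ### The recursion for the differentials of the `h_i` -/

section Frame

variable {E : Type*} [NormedAddCommGroup E] [NormedSpace ℝ E]
  {M : Type*} [TopologicalSpace M] [ChartedSpace E M] [IsManifold 𝓘(ℝ, E) ∞ M]
  {F : Type*} [NormedAddCommGroup F] [NormedSpace ℝ F]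
  {A : M → Type*} [TopologicalSpace (TotalSpace F A)]
  [∀ x, AddCommGroup (A x)] [∀ x, Module ℝ (A x)] [∀ x, TopologicalSpace (A x)]
  [∀ x, IsTopologicalAddGroup (A x)] [∀ x, ContinuousSMul ℝ (A x)]
  [FiberBundle F A] [VectorBundle ℝ F A] [ContMDiffVectorBundle ∞ F A 𝓘(ℝ, E)]

theorem cutoffSec_apply {x : M} {χ : M → ℝ} (hχ : ContMDiff 𝓘(ℝ, E) 𝓘(ℝ, ℝ) ∞ χ)
    (hs : tsupport χ ⊆ (trivializationAt F A x).baseSet) (v : F) (y : M) :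
    cutoffSec F A x hχ hs v y = χ y • (trivializationAt F A x).symmL ℝ y v := rfl

/-- The bracket with `X` on the sections that are constant in the trivialization at `x`, read in
that trivialization. -/
noncomputable def LieAlgebroid.bracketCoord (L : LieAlgebroid E F A) (X : Sec E F A) {x : M}
    {χ : M → ℝ} (hχ : ContMDiff 𝓘(ℝ, E) 𝓘(ℝ, ℝ) ∞ χ)
    (hs : tsupport χ ⊆ (trivializationAt F A x).baseSet) : F →ₗ[ℝ] F where
  toFun v := fibreEquiv F A x (L.bracket X (cutoffSec F A x hχ hs v) x)
  map_add' v w := by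
    have : cutoffSec F A x hχ hs (v + w) = cutoffSec F A x hχ hs v + cutoffSec F A x hχ hs w :=
      ContMDiffSection.ext fun y => by
        rw [ContMDiffSection.coe_add, Pi.add_apply]
        simp only [cutoffSec_apply, map_add, smul_add]
    rw [this, L.bracket_add_right, ContMDiffSection.coe_add, Pi.add_apply, map_add]
  map_smul' c v := by
    have : cutoffSec F A x hχ hs (c • v) = c • cutoffSec F A x hχ hs v :=
      ContMDiffSection.ext fun y => by
        rw [ContMDiffSection.coe_smul, Pi.smul_apply]
        simp only [cutoffSec_apply, map_smul]
        exact smul_comm _ _ _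
    rw [this, L.bracket_smul_right, ContMDiffSection.coe_smul, Pi.smul_apply, map_smul]
    rfl

theorem LieAlgebroid.bracket_sum (L : LieAlgebroid E F A) (X : Sec E F A) {ι : Type*}
    (s : Finset ι) (Y : ι → Sec E F A) :
    L.bracket X (∑ i ∈ s, Y i) = ∑ i ∈ s, L.bracket X (Y i) :=
  map_sum (AddMonoidHom.mk' (L.bracket X) (L.bracket_add_right X)) Y s

theorem sum_apply {ι : Type*} (s : Finset ι) (Y : ι → Sec E F A) (x : M) :
    (∑ i ∈ s, Y i) x = ∑ i ∈ s, Y i x :=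
  map_sum (⟨⟨fun Y => Y x, rfl⟩, fun _ _ => rfl⟩ : Sec E F A →+ A x) Y s

theorem fibreEquiv_symmL (x : M) (v : F) :
    fibreEquiv F A x ((trivializationAt F A x).symmL ℝ x v) = v := by
  have hx := FiberBundle.mem_baseSet_trivializationAt' (F := F) (E := A) x
  rw [← Trivialization.symm_continuousLinearEquivAt_eq _ hx]
  exact (fibreEquiv F A x).apply_symm_apply v

theorem fibreEquiv_coord (N : EndField E F A) (x : M) (v : A x) :
    fibreEquiv F A x (N x v) = N.coord x x (fibreEquiv F A x v) := by
  have hx := FiberBundle.mem_baseSet_trivializationAt' (F := F) (E := A) x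
  rw [N.coord_apply hx]
  have : (trivializationAt F A x).symm x (fibreEquiv F A x v) = v :=
    (trivializationAt F A x).symm_apply_apply_mk hx v
  rw [this]
  rfl

variable [FiniteDimensional ℝ F]

-- Expanding `N` in the local frame and applying the Leibniz rule gives a linear part and the
-- derivative of the matrix of `N`. Hence `ℒ_X N` is that derivative plus a commutator.
open Topology in
theorem LieAlgebroid.bracket_onSec_cutoffSec (L : LieAlgebroid E F A) (N : EndField E F A)
    (X : Sec E F A) {x : M} {χ : M → ℝ} (hχ : ContMDiff 𝓘(ℝ, E) 𝓘(ℝ, ℝ) ∞ χ)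
    (hs : tsupport χ ⊆ (trivializationAt F A x).baseSet) (h1 : χ =ᶠ[𝓝 x] 1) (v : F) :
    fibreEquiv F A x (L.bracket X (N.onSec (cutoffSec F A x hχ hs v)) x) =
      L.bracketCoord X hχ hs (N.coord x x v) +
        mvfderiv 𝓘(ℝ, E) (N.coord x) x (L.anchor x (X x)) v := by
  have hx := FiberBundle.mem_baseSet_trivializationAt' (F := F) (E := A) x
  let b := Module.finBasis ℝ F
  let ℓ : Fin (Module.finrank ℝ F) → (F →L[ℝ] F) →L[ℝ] ℝ := fun i =>
    (LinearMap.toContinuousLinearMap (b.coord i)).comp (ContinuousLinearMap.apply ℝ F v)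
  have hℓ : ∀ i T, ℓ i T = b.repr (T v) i := fun _ _ => rfl
  -- The coefficients of `N` are smooth only over the trivializing set. A second factor `χ` extends
  -- them to `M`, and is harmless because `χ = 1` near `x`.
  let m : Fin (Module.finrank ℝ F) → M → ℝ := fun i y => χ y * ℓ i (N.coord x y)
  have hm : ∀ i, ContMDiff 𝓘(ℝ, E) 𝓘(ℝ, ℝ) ∞ (m i) := fun i =>
    contMDiff_of_tsupport fun y hy => by
      have hy' := hs (tsupport_mul_subset_left hy)
      exact hχ.contMDiffAt.mul
        (((ℓ i).contDiff (n := ∞)).contMDiff.contMDiffAt.comp y (N.contMDiffAt_coord hy'))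
  have hsec : fsmul χ hχ (N.onSec (cutoffSec F A x hχ hs v)) =
      ∑ i, fsmul (m i) (hm i) (cutoffSec F A x hχ hs (b i)) := by
    refine ContMDiffSection.ext fun y => ?_
    rw [sum_apply]
    change χ y • N y (cutoffSec F A x hχ hs v y) =
      ∑ i, m i y • cutoffSec F A x hχ hs (b i) y
    simp only [cutoffSec_apply]
    by_cases hy : y ∈ (trivializationAt F A x).baseSet
    · have h2 : N y ((trivializationAt F A x).symmL ℝ y v) =
          (trivializationAt F A x).symmL ℝ y (∑ i, b.repr (N.coord x y v) i • b i) := by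
        rw [b.sum_repr, Trivialization.symmL_apply _ hy, Trivialization.symmL_apply _ hy]
        exact (N.symm_coord hy v).symm
      rw [map_smul, h2, map_sum, Finset.smul_sum, Finset.smul_sum]
      refine Finset.sum_congr rfl fun i _ => ?_
      rw [map_smul, smul_smul, smul_smul, smul_smul]
      congr 1
      change _ = χ y * b.repr (N.coord x y v) i * χ y
      ring
    · have h0 : χ y = 0 := image_eq_zero_of_notMem_tsupport fun h => hy (hs h)
      simp [h0]
  have hχx : χ x = 1 := h1.eq_of_nhds
  have hdχ : mvfderiv 𝓘(ℝ, E) χ x = 0 := by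
    have : mvfderiv 𝓘(ℝ, E) χ x = mvfderiv 𝓘(ℝ, E) (fun _ => (1 : ℝ)) x := by
      simp only [mvfderiv, h1.mfderiv_eq]
      rfl
    rw [this, mvfderiv_const]
  have hdm : ∀ i w, mvfderiv 𝓘(ℝ, E) (m i) x w =
      b.repr (mvfderiv 𝓘(ℝ, E) (N.coord x) x w v) i := by
    intro i w
    have he : m i =ᶠ[𝓝 x] ℓ i ∘ N.coord x := by
      filter_upwards [h1] with y hy
      simp [m, hy]
    have : mvfderiv 𝓘(ℝ, E) (m i) x = mvfderiv 𝓘(ℝ, E) (ℓ i ∘ N.coord x) x := by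
      simp only [mvfderiv, he.mfderiv_eq]
      rfl
    rw [this, mvfderiv_comp_apply x ((ℓ i).contMDiff (n := ∞) |>.mdifferentiableAt (by simp))
      ((N.contMDiffAt_coord hx).mdifferentiableAt (by simp)), mvfderiv, mfderiv_eq_fderiv,
      (ℓ i).fderiv]
    rfl
  have hb := congrArg (fun Y : Sec E F A => fibreEquiv F A x (L.bracket X Y x)) hsec
  simp only [L.bracket_sum, sum_apply, map_sum, L.leibniz, hdχ, hχx, hdm, one_smul, zero_apply,
    zero_smul, add_zero, map_add, map_smul, cutoffSec_apply, fibreEquiv_symmL] at hb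
  rw [hb, Finset.sum_add_distrib, b.sum_repr]
  congr 1
  rw [← b.sum_repr (N.coord x x v), map_sum]
  refine Finset.sum_congr rfl fun i _ => ?_
  rw [map_smul]
  simp only [m, hχx, one_mul, hℓ]
  rfl

/-- For a Nijenhuis operator `N`, `N^* d_A h_i = d_A h_{i+1}`. -/
theorem LieAlgebroid.IsNijenhuis.dA_hamFun_apply [FiniteDimensional ℝ E] [T2Space M]
    {L : LieAlgebroid E F A} {N : EndField E F A}
    (h : L.IsNijenhuis N) (hN : Nondeg N) (i : ℤ) (x : M) (v : A x) :
    L.dA (hamFun N hN i) x (N x v) = L.dA (hamFun N hN (i + 1)) x v := by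
  have hx := FiberBundle.mem_baseSet_trivializationAt' (F := F) (E := A) x
  obtain ⟨X, rfl⟩ := exists_sec_apply_eq (E := E) (F := F) x v
  obtain ⟨χ, hχ, hs, h1⟩ := exists_contMDiff_cutoff (E := E)
    ((trivializationAt F A x).open_baseSet.mem_nhds hx)
  set n := N.coord x x with hn
  set D := mvfderiv 𝓘(ℝ, E) (N.coord x) x (L.anchor x (X x)) with hD
  set D' := mvfderiv 𝓘(ℝ, E) (N.coord x) x (L.anchor x (N x (X x))) with hD'
  let C := LinearMap.toContinuousLinearMap (L.bracketCoord X hχ hs)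
  let C' := LinearMap.toContinuousLinearMap (L.bracketCoord (N.onSec X) hχ hs)
  -- This is `ℒ_{NX} N = N ℒ_X N` read at `x` in the trivialization.
  have key : D' = n * D + n * (C * n - n * C) - (C' * n - n * C') := by
    ext w
    have h2 := congrArg (fun Y : Sec E F A => fibreEquiv F A x (Y x))
      (h.hereditary X (cutoffSec F A x hχ hs w))
    have h3 : ∀ Y : Sec E F A, N.onSec Y x = N x (Y x) := fun _ => rfl
    simp only [LieAlgebroid.lieEnd, ContMDiffSection.coe_sub, Pi.sub_apply, map_sub,
      L.bracket_onSec_cutoffSec N _ hχ hs h1, h3, fibreEquiv_coord] at h2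
    change C' (n w) + D' w - n (C' w) = n (C (n w) + D w) - n (n (C w)) at h2
    change D' w = n (D w) + n (C (n w) - n (C w)) - (C' (n w) - n (C' w))
    simp only [map_add, map_sub] at h2 ⊢
    linear_combination (norm := module) h2
  simp only [LieAlgebroid.dA, ContinuousLinearMap.comp_apply, mvfderiv_hamFun]
  rw [← hD, ← hD', key]
  have hn' : (coordUnit N hN hx : F →L[ℝ] F) = n := rfl
  have hk : ∀ k : ℤ, (↑(coordUnit N hN hx ^ k) : F →L[ℝ] F) * n =
      ↑(coordUnit N hN hx ^ (k + 1)) := fun k => by rw [zpow_add_one, Units.val_mul, hn']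
  have hk' : ∀ k : ℤ, n * (↑(coordUnit N hN hx ^ k) : F →L[ℝ] F) =
      ↑(coordUnit N hN hx ^ (k + 1)) := fun k => by rw [add_comm, zpow_one_add, Units.val_mul, hn']
  -- Powers of `n` commute with `n`, so cyclicity of the trace kills their products with commutators
  -- `[S, n]`.
  have ht : ∀ (k : ℤ) (S : F →L[ℝ] F),
      traceCLM F (↑(coordUnit N hN hx ^ k) * (S * n - n * S)) = 0 := by
    intro k S
    rw [mul_sub, map_sub, ← mul_assoc, traceCLM_mul_comm, ← mul_assoc, ← mul_assoc, hk, hk',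
      sub_self]
  rw [mul_sub, mul_add, map_sub, map_add, ht, ← mul_assoc, ← mul_assoc, hk, ht, sub_add_cancel,
    add_sub_cancel_right, add_sub_cancel_right]

end Frame

/-! ### The hierarchy and its image on the base -/

section Hierarchy

variable {E : Type*} [NormedAddCommGroup E] [NormedSpace ℝ E] [FiniteDimensional ℝ E]
  {M : Type*} [TopologicalSpace M] [T2Space M] [ChartedSpace E M] [IsManifold 𝓘(ℝ, E) ∞ M]
  {F : Type*} [NormedAddCommGroup F] [NormedSpace ℝ F] [FiniteDimensional ℝ F]
  {A : M → Type*} [TopologicalSpace (TotalSpace F A)]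
  [∀ x, AddCommGroup (A x)] [∀ x, Module ℝ (A x)] [∀ x, TopologicalSpace (A x)]
  [∀ x, IsTopologicalAddGroup (A x)] [∀ x, ContinuousSMul ℝ (A x)]
  [FiberBundle F A] [VectorBundle ℝ F A] [ContMDiffVectorBundle ∞ F A 𝓘(ℝ, E)]

namespace LieAlgebroid

variable {L : LieAlgebroid E F A} {P : TwoTensor E F A} {N : EndField E F A}

theorem IsNijenhuis.dA_hamFun_add (h : L.IsNijenhuis N) (hN : Nondeg N) (i k : ℤ) (x : M) :
    L.dA (hamFun N hN (i + k)) x = (L.dA (hamFun N hN i) x).comp (power N hN k x) := by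
  induction k with
  | zero => rw [add_zero, power_zero]; rfl
  | succ k ih =>
    rw [power_add, ← ContinuousLinearMap.comp_assoc, ← ih, power_one, ← add_assoc]
    exact ContinuousLinearMap.ext fun v => (h.dA_hamFun_apply hN _ x v).symm
  | pred k ih =>
    have h1 : L.dA (hamFun N hN (i + -(k : ℤ))) x =
        (L.dA (hamFun N hN (i + (-(k : ℤ) - 1))) x).comp (power N hN 1 x) := by
      rw [power_one]
      refine ContinuousLinearMap.ext fun v => ?_
      rw [ContinuousLinearMap.comp_apply, h.dA_hamFun_apply]
      congr 3
      ring
    rw [sub_eq_add_neg (-(k : ℤ)) 1, power_add, ← ContinuousLinearMap.comp_assoc, ← ih, h1,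
      ContinuousLinearMap.comp_assoc, ← power_add, add_neg_cancel, power_zero, sub_eq_add_neg]
    rfl

theorem hamFun_one (hN : Nondeg N) :
    hamFun N hN 1 = fun x => LinearMap.trace ℝ (A x) (N x : A x →ₗ[ℝ] A x) := by
  funext x
  simp [hamFun, power_one]

theorem modularVF_eq (hN : Nondeg N) (x : M) :
    L.modularVF P N x = - P x (L.dA (hamFun N hN 1) x) := by
  rw [hamFun_one]
  rfl

/-- In `N^{i+j-1} π^♯ d_A h_1` the factor `N^{j-1}` moves through `π^♯` to become its transpose,
which turns `d_A h_1` into `d_A h_j`. -/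
theorem IsPN.hierarchy_add (h : L.IsPN P N) (hN : Nondeg N) (i j : ℤ) (x : M) :
    L.hierarchy P N hN (i + j) x = L.dP (powerTensor P N hN i) (hamFun N hN j) x := by
  have h1 : L.dA (hamFun N hN j) x =
      (L.dA (hamFun N hN 1) x).comp (powerField N hN (j - 1) x) := by
    rw [powerField_apply, ← h.nijenhuis.dA_hamFun_add, add_sub_cancel]
  rw [hierarchy, modularVF_eq hN, dP, powerTensor, ContinuousLinearMap.comp_apply, h1,
    h.intertwines.powerField hN (j - 1), add_sub_assoc, power_add, map_neg]
  rfl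

theorem contMDiff_hierarchy (hN : Nondeg N) (k : ℤ) :
    ContMDiff 𝓘(ℝ, E) (𝓘(ℝ, E).prod 𝓘(ℝ, F)) ∞
      (fun x => TotalSpace.mk' F x (L.hierarchy P N hN k x)) := by
  have h : (fun x => L.hierarchy P N hN k x) =
      (powerField N hN (k - 1)).onSec (-P.sharp (L.dForm _ (contMDiff_hamFun N hN 1))) := by
    funext x
    rw [hierarchy, modularVF_eq hN]
    rfl
  have h' := ((powerField N hN (k - 1)).onSec
    (-P.sharp (L.dForm _ (contMDiff_hamFun N hN 1)))).contMDiff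
  rw [← h] at h'
  exact h'

theorem IsPN.covered_hierarchy_add (h : L.IsPN P N) (hN : Nondeg N) (i j : ℤ) (x : M) :
    L.covered (L.hierarchy P N hN (i + j)) x =
      - hamVF (L.basePoisson P N hN i) (hamFun N hN j) x := by
  rw [covered, h.hierarchy_add, dP, map_neg]
  rfl

theorem IsPN.isHamiltonian_covered_modularVF (h : L.IsPN P N) (hN : Nondeg N) (i : ℤ) :
    IsHamiltonian (L.basePoisson P N hN i) (L.covered (L.modularVF P N)) := by
  -- The modular field is `X^1 = X^{i + (1 - i)}`, and the minus sign is that of `d_P f = -P^♯ d_A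
  -- f`. The Hamiltonians for `π_0` and `π_1` are thus `-Tr N` and `-ln |det N|`.
  refine ⟨fun x => - hamFun N hN (1 - i) x, (contMDiff_hamFun N hN (1 - i)).neg, fun x => ?_⟩
  have h1 : L.modularVF P N = L.hierarchy P N hN (i + (1 - i)) := by
    funext x
    rw [add_sub_cancel, hierarchy, sub_self, power_zero]
    rfl
  have h2 : mvfderiv 𝓘(ℝ, E) (fun x => - hamFun N hN (1 - i) x) x =
      - mvfderiv 𝓘(ℝ, E) (hamFun N hN (1 - i)) x := mvfderiv_neg
  rw [h1, h.covered_hierarchy_add, hamVF, hamVF, h2, map_neg]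

end LieAlgebroid

end Hierarchy

end PNAlgebroid

theorem mainTheorem6
    {E : Type*} [NormedAddCommGroup E] [NormedSpace ℝ E] [FiniteDimensional ℝ E]
    {M : Type*} [TopologicalSpace M] [T2Space M] [SecondCountableTopology M]
    [ChartedSpace E M] [IsManifold 𝓘(ℝ, E) ∞ M]
    {F : Type*} [NormedAddCommGroup F] [NormedSpace ℝ F] [FiniteDimensional ℝ F]
    {A : M → Type*} [TopologicalSpace (TotalSpace F A)]
    [∀ x, AddCommGroup (A x)] [∀ x, Module ℝ (A x)] [∀ x, TopologicalSpace (A x)]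
    [∀ x, IsTopologicalAddGroup (A x)] [∀ x, ContinuousSMul ℝ (A x)]
    [FiberBundle F A] [VectorBundle ℝ F A] [ContMDiffVectorBundle ∞ F A 𝓘(ℝ, E)]
    (L : PNAlgebroid.LieAlgebroid E F A) (P : PNAlgebroid.TwoTensor E F A)
    (N : PNAlgebroid.EndField E F A) (hPN : L.IsPN P N) (hN : PNAlgebroid.Nondeg N) :
    -- the functions `h_i` are smooth
    (∀ i : ℤ, ContMDiff 𝓘(ℝ, E) 𝓘(ℝ, ℝ) ∞ (PNAlgebroid.hamFun N hN i)) ∧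
    -- the `π_j` are pairwise compatible Poisson structures on `M`
    (∀ j : ℤ, PNAlgebroid.IsPoissonStructure (L.basePoisson P N hN j)) ∧
    (∀ i j : ℤ, PNAlgebroid.IsCompatible (L.basePoisson P N hN i) (L.basePoisson P N hN j)) ∧
    -- the modular vector field covers a bi-Hamiltonian vector field on `M`
    PNAlgebroid.IsBiHamiltonian (L.basePoisson P N hN 0) (L.basePoisson P N hN 1)
      (L.covered (L.modularVF P N)) ∧
    -- the hierarchy of smooth `A`-vector fields determined by the modular vector field
    (∀ k : ℤ, ContMDiff 𝓘(ℝ, E) (𝓘(ℝ, E).prod 𝓘(ℝ, F)) ∞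
      (fun x => TotalSpace.mk' F x (L.hierarchy P N hN k x))) ∧
    (∀ (i j : ℤ) (x : M),
      L.hierarchy P N hN (i + j) x
          = L.dP (PNAlgebroid.powerTensor P N hN i) (PNAlgebroid.hamFun N hN j) x ∧
      L.hierarchy P N hN (i + j) x
          = L.dP (PNAlgebroid.powerTensor P N hN j) (PNAlgebroid.hamFun N hN i) x) ∧
    -- the hierarchy that it covers on `M`
    (∀ (i j : ℤ) (x : M),
      L.covered (L.hierarchy P N hN (i + j)) x
          = - PNAlgebroid.hamVF (L.basePoisson P N hN i) (PNAlgebroid.hamFun N hN j) x ∧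
      L.covered (L.hierarchy P N hN (i + j)) x
          = - PNAlgebroid.hamVF (L.basePoisson P N hN j) (PNAlgebroid.hamFun N hN i) x) := by
  refine ⟨PNAlgebroid.contMDiff_hamFun N hN, hPN.isPoissonStructure_basePoisson hN,
    hPN.isCompatible_basePoisson hN, ⟨hPN.isCompatible_basePoisson hN 0 1,
      hPN.isHamiltonian_covered_modularVF hN 0, hPN.isHamiltonian_covered_modularVF hN 1⟩,
    PNAlgebroid.LieAlgebroid.contMDiff_hierarchy hN,
    fun i j x => ⟨hPN.hierarchy_add hN i j x, ?_⟩,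
    fun i j x => ⟨hPN.covered_hierarchy_add hN i j x, ?_⟩⟩
  · rw [add_comm, hPN.hierarchy_add]
  · rw [add_comm, hPN.covered_hierarchy_add]
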